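/- Let $a\le b$, let $n,p,q\ge 0$ be integers, and let $L_2^n[a,b]$ be the space of square-integrable functions $[a,b]\to\mathbb{R}^n$. For matrix-valued functions $R_0:[a,b]\to\mathbb{R}^{n\times n}$ and $R_1,R_2:[a,b]^2\to\mathbb{R}^{n\times n}$ write $$(\mathcal{P}_{\{R_0,R_1,R_2\}}\mathbf{x})(s)=R_0(s)\mathbf{x}(s)+\int_a^s R_1(s,\theta)\mathbf{x}(\theta)\,d\theta+\int_s^b R_2(s,\theta)\mathbf{x}(\theta)\,d\theta$$ for the corresponding 3-PI operator on $L_2^n[a,b]$. Suppose that $R_0(s)$ is invertible for every $s\in[a,b]$, that the entries of $R_0$ and of $R_0^{-1}$ are measurable and essentially bounded on $[a,b]$, and that $$R_0(s)^{-1}R_i(s,\theta)=-F_i(s)G_i(\theta),\qquad s,\theta\in[a,b],\ i\in\{1,2\},$$ where $F_1,G_1,F_2,G_2$ are square-integrable functions on $[a,b]$ with values in $\mathbb{R}^{n\times p},\mathbb{R}^{p\times n},\mathbb{R}^{n\times q},\mathbb{R}^{q\times n}$ respectively. Put $$A(t)=\begin{bmatrix}G_1(t)F_1(t)&G_1(t)F_2(t)\\-G_2(t)F_1(t)&-G_2(t)F_2(t)\end{bmatrix}.$$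 Then there are unique functions $U,V:[a,b]\to\mathbb{R}^{(p+q)\times(p+q)}$ with $$U(s)=I+\int_a^sA(t)U(t)\,dt,\qquad V(t)=I-\int_a^tV(s)A(s)\,ds .$$ Partition $U=\begin{bmatrix}U_{11}&U_{12}\\U_{21}&U_{22}\end{bmatrix}$ with $U_{11}(s)\in\mathbb{R}^{p\times p}$ and $U_{22}(s)\in\mathbb{R}^{q\times q}$. Then $\mathcal{P}_{\{R_0,R_1,R_2\}}$ is a bounded operator on $L_2^n[a,b]$, and it is (boundedly) invertible if and only if the matrix $U_{22}(b)$ is invertible. In that case $$\left(\mathcal{P}_{\{R_0,R_1,R_2\}}\right)^{-1}=\mathcal{P}_{\{\hat R_0,\hat R_1,\hat R_2\}},\qquad \hat R_0(s)=R_0(s)^{-1},\quad \hat R_i(s,\theta)=L_i(s,\theta)R_0(\theta)^{-1},\ i\in\{1,2\},$$ where $$L_2(s,t)=-\begin{bmatrix}F_1(s)&F_2(s)\end{bmatrix}U(s)PV(t)\begin{bmatrix}G_1(t)\\-G_2(t)\end{bmatrix},\qquad P=\begin{bmatrix}0&0\\U_{22}(b)^{-1}U_{21}(b)&I_q\end{bmatrix},$$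 $$L_1(s,t)=\begin{bmatrix}F_1(s)&F_2(s)\end{bmatrix}U(s)V(t)\begin{bmatrix}G_1(t)\\-G_2(t)\end{bmatrix}+L_2(s,t).$$ -/

import Mathlib

open MeasureTheory Set

noncomputable section

namespace ThreePI

/-- The Hilbert space `L₂ⁿ[a,b]` of square-integrable functions `[a,b] → ℝⁿ`. -/
abbrev L2 (n : ℕ) (a b : ℝ) : Type :=
  Lp (EuclideanSpace ℝ (Fin n)) 2 (volume.restrict (Icc a b))

/-- The matrix-vector product on Euclidean space. -/
def act {n : ℕ} (M : Matrix (Fin n) (Fin n) ℝ) (v : EuclideanSpace ℝ (Fin n)) :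
    EuclideanSpace ℝ (Fin n) :=
  WithLp.toLp 2 (M.mulVec v.ofLp)

/-- All entries of the matrix-valued function `M` are (a.e. measurable and) of class `L^r` on
`[a,b]`. -/
def EntriesMemLp {l m : Type} (r : ENNReal) (a b : ℝ) (M : ℝ → Matrix l m ℝ) : Prop :=
  ∀ i j, MemLp (fun s => M s i j) r (volume.restrict (Icc a b))

/-- The bounded operator `T` on `L₂ⁿ[a,b]` is the 3-PI operator with parameters `R₀, R₁, R₂`:
for every `x`, for a.e. `s ∈ [a,b]`, both integrals exist and
`(T x)(s) = R₀(s) x(s) + ∫_a^s R₁(s,θ) x(θ) dθ + ∫_s^b R₂(s,θ) x(θ) dθ`. -/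
def IsThreePI {n : ℕ} {a b : ℝ} (R₀ : ℝ → Matrix (Fin n) (Fin n) ℝ)
    (R₁ R₂ : ℝ → ℝ → Matrix (Fin n) (Fin n) ℝ) (T : L2 n a b →L[ℝ] L2 n a b) : Prop :=
  ∀ x : L2 n a b, ∀ᵐ s ∂(volume.restrict (Icc a b)),
    IntervalIntegrable (fun θ => act (R₁ s θ) (x θ)) volume a s ∧
    IntervalIntegrable (fun θ => act (R₂ s θ) (x θ)) volume s b ∧
    (T x) s = act (R₀ s) (x s) + (∫ θ in a..s, act (R₁ s θ) (x θ))
      + ∫ θ in s..b, act (R₂ s θ) (x θ)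

section Construction

variable {n p q : ℕ}

/-- The row `[F₁(s) F₂(s)]`. -/
def rowF (F₁ : ℝ → Matrix (Fin n) (Fin p) ℝ) (F₂ : ℝ → Matrix (Fin n) (Fin q) ℝ) (s : ℝ) :
    Matrix (Fin n) (Fin p ⊕ Fin q) ℝ :=
  Matrix.fromCols (F₁ s) (F₂ s)

/-- The column `[G₁(t); -G₂(t)]`. -/
def colG (G₁ : ℝ → Matrix (Fin p) (Fin n) ℝ) (G₂ : ℝ → Matrix (Fin q) (Fin n) ℝ) (t : ℝ) :
    Matrix (Fin p ⊕ Fin q) (Fin n) ℝ :=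
  Matrix.fromRows (G₁ t) (-(G₂ t))

/-- The coefficient matrix `[G₁F₁, G₁F₂; -G₂F₁, -G₂F₂]`. -/
def coeff (F₁ : ℝ → Matrix (Fin n) (Fin p) ℝ) (G₁ : ℝ → Matrix (Fin p) (Fin n) ℝ)
    (F₂ : ℝ → Matrix (Fin n) (Fin q) ℝ) (G₂ : ℝ → Matrix (Fin q) (Fin n) ℝ) (t : ℝ) :
    Matrix (Fin p ⊕ Fin q) (Fin p ⊕ Fin q) ℝ :=
  Matrix.fromBlocks (G₁ t * F₁ t) (G₁ t * F₂ t) (-(G₂ t * F₁ t)) (-(G₂ t * F₂ t))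

/-- `U` is the fundamental matrix of `z' = A z` on `[a,b]`, normalized at `a`:
`U(s) = I + ∫_a^s A(t) U(t) dt` for all `s ∈ [a,b]`, the integral existing entrywise. -/
def IsFundamental (a b : ℝ) (A U : ℝ → Matrix (Fin p ⊕ Fin q) (Fin p ⊕ Fin q) ℝ) : Prop :=
  ∀ i j, IntervalIntegrable (fun t => (A t * U t) i j) volume a b ∧
    ∀ s ∈ Icc a b, U s i j =
      (1 : Matrix (Fin p ⊕ Fin q) (Fin p ⊕ Fin q) ℝ) i j + ∫ t in a..s, (A t * U t) i j

/-- `V` solves the adjoint equation `V(t) = I - ∫_a^t V(s) A(s) ds` for all `t ∈ [a,b]`, the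
integral existing entrywise. -/
def IsAdjointFundamental (a b : ℝ) (A V : ℝ → Matrix (Fin p ⊕ Fin q) (Fin p ⊕ Fin q) ℝ) :
    Prop :=
  ∀ i j, IntervalIntegrable (fun s => (V s * A s) i j) volume a b ∧
    ∀ t ∈ Icc a b, V t i j =
      (1 : Matrix (Fin p ⊕ Fin q) (Fin p ⊕ Fin q) ℝ) i j - ∫ s in a..t, (V s * A s) i j

/-- The matrix `P = [0, 0; U₂₂(b)⁻¹ U₂₁(b), I]`, as a function of `U(b)`. -/
def projP (Ub : Matrix (Fin p ⊕ Fin q) (Fin p ⊕ Fin q) ℝ) :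
    Matrix (Fin p ⊕ Fin q) (Fin p ⊕ Fin q) ℝ :=
  Matrix.fromBlocks 0 0 (Ub.toBlocks₂₂⁻¹ * Ub.toBlocks₂₁) 1

/-- `L₂(s,t) = -[F₁(s) F₂(s)] U(s) P V(t) [G₁(t); -G₂(t)]`. -/
def kerL₂ (b : ℝ) (F₁ : ℝ → Matrix (Fin n) (Fin p) ℝ) (G₁ : ℝ → Matrix (Fin p) (Fin n) ℝ)
    (F₂ : ℝ → Matrix (Fin n) (Fin q) ℝ) (G₂ : ℝ → Matrix (Fin q) (Fin n) ℝ)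
    (U V : ℝ → Matrix (Fin p ⊕ Fin q) (Fin p ⊕ Fin q) ℝ) (s t : ℝ) :
    Matrix (Fin n) (Fin n) ℝ :=
  -(rowF F₁ F₂ s * U s * projP (U b) * V t * colG G₁ G₂ t)

/-- `L₁(s,t) = [F₁(s) F₂(s)] U(s) V(t) [G₁(t); -G₂(t)] + L₂(s,t)`. -/
def kerL₁ (b : ℝ) (F₁ : ℝ → Matrix (Fin n) (Fin p) ℝ) (G₁ : ℝ → Matrix (Fin p) (Fin n) ℝ)
    (F₂ : ℝ → Matrix (Fin n) (Fin q) ℝ) (G₂ : ℝ → Matrix (Fin q) (Fin n) ℝ)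
    (U V : ℝ → Matrix (Fin p ⊕ Fin q) (Fin p ⊕ Fin q) ℝ) (s t : ℝ) :
    Matrix (Fin n) (Fin n) ℝ :=
  rowF F₁ F₂ s * U s * V t * colG G₁ G₂ t + kerL₂ b F₁ G₁ F₂ G₂ U V s t

end Construction

end ThreePI

end

/-!
Let `x` be a function on `[a,b]` and let `z` be the primitive of `[G₁; -G₂] x` whose first block
vanishes at `a` and whose second block vanishes at `b`. Then the 3-PI operator is
`x ↦ R₀ (x - [F₁ F₂] z)`, so that `f` is the image of `x` precisely when `x = y + [F₁ F₂] z` with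
`y = R₀⁻¹ f`. Substituting this into `z' = [G₁; -G₂] x` turns inverting the operator into solving
the boundary value problem `z' = A z + [G₁; -G₂] y`, `z₁(a) = 0`, `z₂(b) = 0`.

By variation of constants the solutions of the differential equation are
`z(s) = U(s) (z(a) + ∫_a^s V(t) [G₁; -G₂] y(t) dt)`. If `U₂₂(b)` is invertible, then the boundary
conditions determine `z(a)`, and substituting its value gives the kernels of the inverse operator.
If `U₂₂(b) c = 0` with `c ≠ 0`, then `z = U [0; c]` solves the homogeneous problem, and `[F₁ F₂] z`
lies in the kernel of the operator; it is nonzero because it determines `z`.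
-/

namespace ThreePI

section Primitive

theorem intervalIntegrable_of_mem_uIcc {E : Type*} [NormedAddCommGroup E] {f : ℝ → E}
    {a b c d : ℝ} (hf : IntervalIntegrable f volume a b) (hc : c ∈ uIcc a b) (hd : d ∈ uIcc a b) :
    IntervalIntegrable f volume c d :=
  hf.mono_set (uIcc_subset_uIcc hc hd)

theorem intervalIntegrable_iff_memLp_one {E : Type*} [NormedAddCommGroup E] {f : ℝ → E} {a b : ℝ}
    (hab : a ≤ b) :
    IntervalIntegrable f volume a b ↔ MemLp f 1 (volume.restrict (Icc a b)) := by
  rw [intervalIntegrable_iff_integrableOn_Icc_of_le hab, IntegrableOn, memLp_one_iff_integrable]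

theorem memLp_top_of_continuousOn {E : Type*} [NormedAddCommGroup E] {f : ℝ → E} {a b : ℝ}
    (hf : ContinuousOn f (Icc a b)) : MemLp f ⊤ (volume.restrict (Icc a b)) := by
  obtain ⟨C, hC⟩ := isCompact_Icc.exists_bound_of_continuousOn hf
  exact memLp_top_of_bound (hf.aestronglyMeasurable measurableSet_Icc) C
    (ae_restrict_of_forall_mem measurableSet_Icc hC)

theorem ae_restrict_Icc_iff {a b : ℝ} (hab : a ≤ b) {P : ℝ → Prop} :
    (∀ᵐ s ∂volume.restrict (Icc a b), P s) ↔ ∀ᵐ s, s ∈ uIoc a b → P s := by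
  rw [Measure.restrict_congr_set Ioc_ae_eq_Icc.symm, ← uIoc_of_le hab,
    ae_restrict_iff' measurableSet_uIoc]

variable {E F G : Type*} [NormedAddCommGroup E] [NormedSpace ℝ E] [NormedAddCommGroup F]
  [NormedSpace ℝ F] [NormedAddCommGroup G] [NormedSpace ℝ G] {a b : ℝ}

theorem absolutelyContinuousOnInterval_of_dist_le {X Y : Type*} [PseudoMetricSpace X]
    [PseudoMetricSpace Y] {f : ℝ → X} {φ : ℝ → Y} (hφ : AbsolutelyContinuousOnInterval φ a b)
    (h : ∀ x ∈ uIcc a b, ∀ y ∈ uIcc a b, dist (f x) (f y) ≤ dist (φ x) (φ y)) :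
    AbsolutelyContinuousOnInterval f a b := by
  rw [absolutelyContinuousOnInterval_iff] at hφ ⊢
  intro ε hε
  obtain ⟨δ, hδ, hlt⟩ := hφ ε hε
  refine ⟨δ, hδ, fun I hI hlen => (Finset.sum_le_sum fun i hi => ?_).trans_lt (hlt I hI hlen)⟩
  exact h _ (hI.1 i hi).1 _ (hI.1 i hi).2

theorem absolutelyContinuousOnInterval_clm_apply₂ (B : E →L[ℝ] F →L[ℝ] G) {f : ℝ → E} {g : ℝ → F}
    (hf : AbsolutelyContinuousOnInterval f a b) (hg : AbsolutelyContinuousOnInterval g a b) :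
    AbsolutelyContinuousOnInterval (fun s => B (f s) (g s)) a b := by
  obtain ⟨C, hC⟩ := hf.exists_bound
  obtain ⟨D, hD⟩ := hg.exists_bound
  unfold AbsolutelyContinuousOnInterval at hf hg
  refine squeeze_zero' (.of_forall fun _ => Finset.sum_nonneg fun _ _ => dist_nonneg) ?_
    (by simpa using (hg.const_mul (‖B‖ * C)).add (hf.const_mul (‖B‖ * D)))
  rw [Filter.eventually_inf_principal]
  refine .of_forall fun I hI => ?_
  rw [Finset.mul_sum, Finset.mul_sum, ← Finset.sum_add_distrib]
  refine Finset.sum_le_sum fun i hi => ?_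
  obtain ⟨hx, hy⟩ := hI.1 i hi
  set x := (I.2 i).1
  set y := (I.2 i).2
  have hsplit : B (f x) (g x) - B (f y) (g y) = B (f x) (g x - g y) + B (f x - f y) (g y) := by
    simp only [map_sub, sub_apply]
    abel
  rw [dist_eq_norm, dist_eq_norm, dist_eq_norm, hsplit]
  calc ‖B (f x) (g x - g y) + B (f x - f y) (g y)‖
      ≤ ‖B‖ * ‖f x‖ * ‖g x - g y‖ + ‖B‖ * ‖f x - f y‖ * ‖g y‖ :=
        norm_add_le_of_le (B.le_opNorm₂ _ _) (B.le_opNorm₂ _ _)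
    _ ≤ ‖B‖ * C * ‖g x - g y‖ + ‖B‖ * ‖f x - f y‖ * D := by
        gcongr
        exacts [hC x hx, hD y hy]
    _ = ‖B‖ * C * ‖g x - g y‖ + ‖B‖ * D * ‖f x - f y‖ := by ring

/-- `f` is a primitive of the integrable function `f'` on the interval between `a` and `b`. In
finite dimension this says that `f` is absolutely continuous with a.e. derivative `f'`, so that
`IsPrimitiveOn a b z fun t => A t *ᵥ z t` is the Carathéodory form of the equation `z' = A z`. -/
def IsPrimitiveOn (a b : ℝ) (f f' : ℝ → E) : Prop :=
  IntervalIntegrable f' volume a b ∧ ∀ s ∈ uIcc a b, f s = f a + ∫ t in a..s, f' t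

theorem intervalIntegrable_clm_apply₂ (B : E →L[ℝ] F →L[ℝ] G) {f : ℝ → E} {g : ℝ → F}
    (hf : IntervalIntegrable f volume a b) (hg : ContinuousOn g (uIcc a b)) :
    IntervalIntegrable (fun s => B (f s) (g s)) volume a b := by
  rw [intervalIntegrable_iff] at hf ⊢
  obtain ⟨C, hC⟩ := isCompact_uIcc.exists_bound_of_continuousOn hg
  refine B.integrable_of_bilin_of_bdd_right C hf
    ((hg.mono uIoc_subset_uIcc).aestronglyMeasurable measurableSet_uIoc) ?_
  exact (ae_restrict_mem measurableSet_uIoc).mono fun t ht => hC t (uIoc_subset_uIcc ht)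

theorem isPrimitiveOn_integral {f' : ℝ → E} (hf' : IntervalIntegrable f' volume a b) {c : ℝ}
    (hc : c ∈ uIcc a b) : IsPrimitiveOn a b (fun s => ∫ t in c..s, f' t) f' :=
  ⟨hf', fun _ hs => (intervalIntegral.integral_add_adjacent_intervals
    (intervalIntegrable_of_mem_uIcc hf' hc left_mem_uIcc)
    (intervalIntegrable_of_mem_uIcc hf' left_mem_uIcc hs)).symm⟩

namespace IsPrimitiveOn

variable {f f' : ℝ → E} {g g' : ℝ → F}

theorem eq_add_integral (hf : IsPrimitiveOn a b f f') {c s : ℝ} (hc : c ∈ uIcc a b)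
    (hs : s ∈ uIcc a b) : f s = f c + ∫ t in c..s, f' t := by
  rw [hf.2 s hs, hf.2 c hc, add_assoc, intervalIntegral.integral_add_adjacent_intervals
    (intervalIntegrable_of_mem_uIcc hf.1 left_mem_uIcc hc)
    (intervalIntegrable_of_mem_uIcc hf.1 hc hs)]

theorem sub_eq_sub (hf : IsPrimitiveOn a b f f') {f₁ : ℝ → E} (hf₁ : IsPrimitiveOn a b f₁ f')
    {c s : ℝ} (hc : c ∈ uIcc a b) (hs : s ∈ uIcc a b) : f s - f c = f₁ s - f₁ c := by
  rw [hf.eq_add_integral hc hs, hf₁.eq_add_integral hc hs, add_sub_cancel_left,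
    add_sub_cancel_left]

theorem congr_ae (hf : IsPrimitiveOn a b f f') {f'' : ℝ → E}
    (h : ∀ᵐ t, t ∈ uIoc a b → f' t = f'' t) : IsPrimitiveOn a b f f'' := by
  refine ⟨hf.1.congr_ae ((ae_restrict_iff' measurableSet_uIoc).2 h), fun s hs => ?_⟩
  rw [hf.2 s hs]
  congr 1
  refine intervalIntegral.integral_congr_ae (h.mono fun t ht hts => ht ?_)
  exact uIoc_subset_uIoc_of_uIcc_subset_uIcc (uIcc_subset_uIcc left_mem_uIcc hs) hts

theorem const_add (hf : IsPrimitiveOn a b f f') (c : E) :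
    IsPrimitiveOn a b (fun s => c + f s) f' :=
  ⟨hf.1, fun s hs => by simp only [hf.2 s hs, add_assoc]⟩

theorem dist_le_dist_integral_norm (hf : IsPrimitiveOn a b f f') {x y : ℝ} (hx : x ∈ uIcc a b)
    (hy : y ∈ uIcc a b) :
    dist (f x) (f y) ≤ dist (∫ t in a..x, ‖f' t‖) (∫ t in a..y, ‖f' t‖) := by
  rw [dist_eq_norm, Real.dist_eq, intervalIntegral.integral_interval_sub_left
    (intervalIntegrable_of_mem_uIcc hf.1.norm left_mem_uIcc hx)
    (intervalIntegrable_of_mem_uIcc hf.1.norm left_mem_uIcc hy), hf.eq_add_integral hy hx,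
    add_sub_cancel_left]
  exact intervalIntegral.norm_integral_le_abs_integral_norm

theorem absolutelyContinuousOnInterval (hf : IsPrimitiveOn a b f f') :
    AbsolutelyContinuousOnInterval f a b :=
  absolutelyContinuousOnInterval_of_dist_le
    (hf.1.norm.absolutelyContinuousOnInterval_intervalIntegral left_mem_uIcc)
    fun _ hx _ hy => hf.dist_le_dist_integral_norm hx hy

theorem continuousOn (hf : IsPrimitiveOn a b f f') : ContinuousOn f (uIcc a b) :=
  hf.absolutelyContinuousOnInterval.continuousOn

theorem ae_hasDerivAt [CompleteSpace E] (hf : IsPrimitiveOn a b f f') :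
    ∀ᵐ s, s ∈ uIcc a b → HasDerivAt f (f' s) s := by
  have hmin : ∀ᵐ s : ℝ, s ≠ min a b := by simp [ae_iff, measure_singleton]
  have hmax : ∀ᵐ s : ℝ, s ≠ max a b := by simp [ae_iff, measure_singleton]
  filter_upwards [hf.1.ae_hasDerivAt_integral, hmin, hmax] with s hderiv hs_min hs_max hs
  refine ((hderiv hs a left_mem_uIcc).const_add (f a)).congr_of_eventuallyEq ?_
  have hnhds : uIcc a b ∈ nhds s :=
    Icc_mem_nhds (lt_of_le_of_ne hs.1 hs_min.symm) (lt_of_le_of_ne hs.2 hs_max)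
  filter_upwards [hnhds] with t ht using hf.2 t ht

theorem of_ae_hasDerivAt [CompleteSpace E] (hf : AbsolutelyContinuousOnInterval f a b)
    (hf' : IntervalIntegrable f' volume a b)
    (hderiv : ∀ᵐ s, s ∈ uIcc a b → HasDerivAt f (f' s) s) : IsPrimitiveOn a b f f' := by
  have hF := isPrimitiveOn_integral hf' left_mem_uIcc
  obtain ⟨C, hC⟩ : ∃ C, ∀ s ∈ uIcc a b, f s - ∫ t in a..s, f' t = C := by
    refine (hf.fun_sub hF.absolutelyContinuousOnInterval).const_of_ae_hasDerivAt_zero ?_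
    filter_upwards [hderiv, hF.ae_hasDerivAt] with s hfs hFs hs
    simpa using (hfs hs).fun_sub (hFs hs)
  refine ⟨hf', fun s hs => ?_⟩
  have hCa := hC a left_mem_uIcc
  rw [intervalIntegral.integral_same, sub_zero] at hCa
  rw [hCa, ← hC s hs, sub_add_cancel]

theorem clm_comp [CompleteSpace E] [CompleteSpace F] (L : E →L[ℝ] F) (hf : IsPrimitiveOn a b f f') :
    IsPrimitiveOn a b (fun s => L (f s)) (fun s => L (f' s)) := by
  refine ⟨⟨L.integrable_comp hf.1.1, L.integrable_comp hf.1.2⟩, fun s hs => ?_⟩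
  simp only
  rw [hf.2 s hs, map_add, L.intervalIntegral_comp_comm
    (intervalIntegrable_of_mem_uIcc hf.1 left_mem_uIcc hs)]

theorem clm_apply₂ [CompleteSpace E] [CompleteSpace F] [CompleteSpace G] (B : E →L[ℝ] F →L[ℝ] G)
    (hf : IsPrimitiveOn a b f f') (hg : IsPrimitiveOn a b g g') :
    IsPrimitiveOn a b (fun s => B (f s) (g s)) (fun s => B (f s) (g' s) + B (f' s) (g s)) := by
  refine of_ae_hasDerivAt (absolutelyContinuousOnInterval_clm_apply₂ B
    hf.absolutelyContinuousOnInterval hg.absolutelyContinuousOnInterval) ?_ ?_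
  · exact (intervalIntegrable_clm_apply₂ B.flip hg.1 hf.continuousOn).add
      (intervalIntegrable_clm_apply₂ B hf.1 hg.continuousOn)
  · filter_upwards [hf.ae_hasDerivAt, hg.ae_hasDerivAt] with s hfs hgs hs
    exact B.hasDerivAt_of_bilinear (fun _ => hfs hs) (fun _ => hgs hs)

end IsPrimitiveOn

theorem isPrimitiveOn_pi_iff {ι : Type*} [Fintype ι] {E : ι → Type*}
    [∀ i, NormedAddCommGroup (E i)] [∀ i, NormedSpace ℝ (E i)] [∀ i, CompleteSpace (E i)]
    {f f' : ℝ → ∀ i, E i} :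
    IsPrimitiveOn a b f f' ↔ ∀ i, IsPrimitiveOn a b (f · i) (f' · i) := by
  refine ⟨fun hf i => hf.clm_comp (ContinuousLinearMap.proj i), fun hf => ?_⟩
  have hf' : IntervalIntegrable f' volume a b :=
    ⟨Integrable.of_eval fun i => (hf i).1.1, Integrable.of_eval fun i => (hf i).1.2⟩
  refine ⟨hf', fun s hs => funext fun i => ((hf i).2 s hs).trans (congrArg (f a i + ·) ?_)⟩
  exact (ContinuousLinearMap.proj (R := ℝ) (φ := E) i).intervalIntegral_comp_comm
    (intervalIntegrable_of_mem_uIcc hf' left_mem_uIcc hs)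

theorem isPrimitiveOn_sum_elim_iff {ι κ : Type*} [Fintype ι] [Fintype κ] {f f' : ℝ → ι → ℝ}
    {g g' : ℝ → κ → ℝ} :
    IsPrimitiveOn a b (fun s => Sum.elim (f s) (g s)) (fun s => Sum.elim (f' s) (g' s)) ↔
      IsPrimitiveOn a b f f' ∧ IsPrimitiveOn a b g g' := by
  simp only [isPrimitiveOn_pi_iff, Sum.forall, Sum.elim_inl, Sum.elim_inr]

end Primitive

section Volterra

variable {E : Type*} [NormedAddCommGroup E] [NormedSpace ℝ E] {a b : ℝ} {L : ℝ → E →L[ℝ] E}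

theorem IsPrimitiveOn.pow_succ_div_factorial {f f' : ℝ → ℝ} (hf : IsPrimitiveOn a b f f') (n : ℕ) :
    IsPrimitiveOn a b (fun s => f s ^ (n + 1) / (n + 1).factorial)
      (fun s => f' s * (f s ^ n / n.factorial)) := by
  induction n with
  | zero => simpa using hf
  | succ n ih =>
    have hprod := (hf.clm_apply₂ (ContinuousLinearMap.mul ℝ ℝ) ih).clm_comp
      (ContinuousLinearMap.mul ℝ ℝ ((n + 1 + 1 : ℝ)⁻¹))
    convert hprod using 2 with s s
    · simp only [ContinuousLinearMap.mul_apply', Nat.factorial_succ (n + 1), pow_succ' _ (n + 1)]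
      push_cast
      field_simp
    · simp only [ContinuousLinearMap.mul_apply', Nat.factorial_succ n, pow_succ' _ n]
      push_cast
      field_simp

theorem norm_integral_clm_apply_le (hab : a ≤ b) {z : ℝ → E} {φ : ℝ → ℝ}
    (hφ : IntervalIntegrable (fun t => ‖L t‖ * φ t) volume a b)
    (hz : ∀ t ∈ Icc a b, ‖z t‖ ≤ φ t) :
    ‖∫ t in a..b, L t (z t)‖ ≤ ∫ t in a..b, ‖L t‖ * φ t :=
  intervalIntegral.norm_integral_le_of_norm_le hab
    (.of_forall fun t ht => (L t).le_opNorm_of_le (hz t (Ioc_subset_Icc_self ht))) hφ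

theorem intervalIntegrable_clm_apply_IccExtend (hab : a ≤ b) (hL : IntervalIntegrable L volume a b)
    (z : C(Icc a b, E)) : IntervalIntegrable (fun t => L t (IccExtend hab z t)) volume a b :=
  intervalIntegrable_clm_apply₂ (.id ℝ (E →L[ℝ] E)) hL z.continuous.Icc_extend'.continuousOn

/-- The Volterra operator `z ↦ ∫_a^s L(t) z(t) dt` on the continuous functions on `[a,b]`. -/
noncomputable def volterra (hab : a ≤ b) (hL : IntervalIntegrable L volume a b) :
    C(Icc a b, E) →L[ℝ] C(Icc a b, E) :=
  LinearMap.mkContinuous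
    { toFun := fun z => ⟨fun s => ∫ t in a..s, L t (IccExtend hab z t),
        continuousOn_iff_continuous_domRestrict.1 <| by
          simpa only [uIcc_of_le hab] using (isPrimitiveOn_integral
            (intervalIntegrable_clm_apply_IccExtend hab hL z) left_mem_uIcc).continuousOn⟩
      map_add' := fun z w => by
        ext s
        have hs : (s : ℝ) ∈ uIcc a b := Icc_subset_uIcc s.2
        simp only [IccExtend_apply, ContinuousMap.add_apply, map_add, ContinuousMap.coe_mk]
        exact intervalIntegral.integral_add
          (intervalIntegrable_of_mem_uIcc (intervalIntegrable_clm_apply_IccExtend hab hL z)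
            left_mem_uIcc hs)
          (intervalIntegrable_of_mem_uIcc (intervalIntegrable_clm_apply_IccExtend hab hL w)
            left_mem_uIcc hs)
      map_smul' := fun c z => by
        ext s
        simp [IccExtend_apply] }
    (∫ t in a..b, ‖L t‖) fun z => by
      have hnn : 0 ≤ ∫ t in a..b, ‖L t‖ :=
        intervalIntegral.integral_nonneg hab fun t _ => norm_nonneg _
      refine (ContinuousMap.norm_le _ (by positivity)).2 fun s => ?_
      refine (norm_integral_clm_apply_le s.2.1 (φ := fun _ => ‖z‖) ?_
        fun t _ => z.norm_coe_le_norm _).trans ?_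
      · exact intervalIntegrable_of_mem_uIcc (hL.norm.mul_const _) left_mem_uIcc
          (Icc_subset_uIcc s.2)
      · rw [intervalIntegral.integral_mul_const]
        gcongr
        exact intervalIntegral.integral_mono_interval le_rfl s.2.1 s.2.2
          (.of_forall fun _ => norm_nonneg _) hL.norm

theorem volterra_apply (hab : a ≤ b) (hL : IntervalIntegrable L volume a b) (z : C(Icc a b, E))
    (s : Icc a b) : volterra hab hL z s = ∫ t in a..s, L t (IccExtend hab z t) :=
  rfl

theorem norm_volterra_pow_apply_le (hab : a ≤ b) (hL : IntervalIntegrable L volume a b)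
    (z : C(Icc a b, E)) (n : ℕ) (s : Icc a b) :
    ‖(volterra hab hL ^ n) z s‖ ≤ ‖z‖ * ((∫ t in a..s, ‖L t‖) ^ n / n.factorial) := by
  induction n generalizing s with
  | zero => simpa using z.norm_coe_le_norm s
  | succ n ih =>
    set α : ℝ → ℝ := fun s => ∫ t in a..s, ‖L t‖
    have hprim := ((isPrimitiveOn_integral hL.norm left_mem_uIcc).pow_succ_div_factorial n).clm_comp
      (ContinuousLinearMap.mul ℝ ℝ ‖z‖)
    have hs : (s : ℝ) ∈ uIcc a b := Icc_subset_uIcc s.2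
    have hcomm : ∀ t, ‖L t‖ * (‖z‖ * (α t ^ n / n.factorial)) =
        ‖z‖ * (‖L t‖ * (α t ^ n / n.factorial)) := fun t => by ring
    rw [pow_succ', mul_apply_eq_comp, volterra_apply]
    calc ‖∫ t in a..s, L t (IccExtend hab ((volterra hab hL ^ n) z) t)‖
        ≤ ∫ t in a..s, ‖L t‖ * (‖z‖ * (α t ^ n / n.factorial)) := by
          refine norm_integral_clm_apply_le s.2.1 ?_ fun t ht => ?_
          · simp only [hcomm]
            exact intervalIntegrable_of_mem_uIcc hprim.1 left_mem_uIcc hs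
          · have hmem : t ∈ Icc a b := ⟨ht.1, ht.2.trans s.2.2⟩
            simpa only [IccExtend_of_mem hab _ hmem] using ih ⟨t, hmem⟩
      _ = ‖z‖ * (α s ^ (n + 1) / (n + 1).factorial) := by
          simpa [hcomm, α] using (hprim.2 s hs).symm

theorem norm_volterra_pow_le (hab : a ≤ b) (hL : IntervalIntegrable L volume a b) (n : ℕ)
    (z : C(Icc a b, E)) :
    ‖(volterra hab hL ^ n) z‖ ≤ (∫ t in a..b, ‖L t‖) ^ n / n.factorial * ‖z‖ := by
  have hnn : ∀ s ∈ Icc a b, 0 ≤ ∫ t in a..s, ‖L t‖ := fun s hs =>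
    intervalIntegral.integral_nonneg hs.1 fun _ _ => norm_nonneg _
  have hnn_b := hnn b (right_mem_Icc.2 hab)
  rw [mul_comm]
  refine (ContinuousMap.norm_le _ (by positivity)).2 fun s => ?_
  refine (norm_volterra_pow_apply_le hab hL z n s).trans ?_
  gcongr
  · exact hnn s s.2
  · exact intervalIntegral.integral_mono_interval le_rfl s.2.1 s.2.2
      (.of_forall fun _ => norm_nonneg _) hL.norm

theorem exists_eq_add_of_norm_pow_le {X : Type*} [NormedAddCommGroup X] [NormedSpace ℝ X]
    [CompleteSpace X] (K : X →L[ℝ] X) {α : ℝ} (hα : 0 ≤ α)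
    (hK : ∀ (n : ℕ) (x : X), ‖(K ^ n) x‖ ≤ α ^ n / n.factorial * ‖x‖) (x : X) :
    ∃ w, w = x + K w := by
  have hsum : Summable fun n : ℕ => K ^ n :=
    .of_norm_bounded (Real.summable_pow_div_factorial α) fun n =>
      (K ^ n).opNorm_le_bound (by positivity) (hK n)
  refine ⟨(∑' n : ℕ, K ^ n) x, sub_eq_iff_eq_add.1 ?_⟩
  exact DFunLike.congr_fun hsum.one_sub_mul_tsum_pow x

theorem exists_isPrimitiveOn_clm_apply [CompleteSpace E] (hab : a ≤ b)
    (hL : IntervalIntegrable L volume a b) (c : E) :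
    ∃ z : ℝ → E, z a = c ∧ IsPrimitiveOn a b z (fun t => L t (z t)) := by
  obtain ⟨w, hw⟩ := exists_eq_add_of_norm_pow_le (volterra hab hL)
    (intervalIntegral.integral_nonneg hab fun _ _ => norm_nonneg _) (norm_volterra_pow_le hab hL)
    (.const _ c)
  replace hw : ∀ s : Icc a b, w s = c + ∫ t in a..s, L t (IccExtend hab w t) :=
    fun s => DFunLike.congr_fun hw s
  have hwa : IccExtend hab w a = c := by simpa [IccExtend_left] using hw ⟨a, left_mem_Icc.2 hab⟩
  refine ⟨IccExtend hab w, hwa, intervalIntegrable_clm_apply_IccExtend hab hL w, fun s hs => ?_⟩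
  rw [uIcc_of_le hab] at hs
  rw [hwa, IccExtend_of_mem hab _ hs, hw]

end Volterra

open scoped Matrix Matrix.Norms.Elementwise

/-- The topology of the elementwise norm. Instance search would otherwise find
`instTopologicalSpaceMatrix`, which does not match the norm at instance transparency. -/
local instance elementwiseTopology {l m : Type*} [Fintype l] [Fintype m] :
    TopologicalSpace (Matrix l m ℝ) :=
  PseudoMetricSpace.toUniformSpace.toTopologicalSpace

section Matrices

variable {l m : Type} [Fintype l] [Fintype m]

theorem isPrimitiveOn_matrix_iff {a b : ℝ} {M M' : ℝ → Matrix l m ℝ} :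
    IsPrimitiveOn a b M M' ↔ ∀ i j, IsPrimitiveOn a b (M · i j) (M' · i j) :=
  isPrimitiveOn_pi_iff.trans (forall_congr' fun _ => isPrimitiveOn_pi_iff)

theorem entriesMemLp_iff {r : ENNReal} {a b : ℝ} {M : ℝ → Matrix l m ℝ} :
    EntriesMemLp r a b M ↔ MemLp M r (volume.restrict (Icc a b)) :=
  ((forall_congr' fun _ => memLp_pi_iff).symm.trans memLp_pi_iff.symm)

theorem isPrimitiveOn_matrix_one_add_iff [DecidableEq l] {a b : ℝ} {M M' : ℝ → Matrix l l ℝ}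
    (hab : a ≤ b) :
    (∀ i j, IntervalIntegrable (M' · i j) volume a b ∧ ∀ s ∈ Icc a b,
      M s i j = (1 : Matrix l l ℝ) i j + ∫ t in a..s, M' t i j) ↔
    M a = 1 ∧ IsPrimitiveOn a b M M' := by
  rw [isPrimitiveOn_matrix_iff, ← uIcc_of_le hab]
  constructor
  · intro h
    have hone : M a = 1 := by
      ext i j
      simpa using (h i j).2 a left_mem_uIcc
    refine ⟨hone, fun i j => ⟨(h i j).1, fun s hs => ?_⟩⟩
    simp only [hone, (h i j).2 s hs]
  · rintro ⟨hone, h⟩ i j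
    exact ⟨(h i j).1, fun s hs => by rw [← hone]; exact (h i j).2 s hs⟩

end Matrices

section Fundamental

/-- Matrix multiplication as a continuous bilinear map. -/
noncomputable def mulL (l m k : Type*) [Fintype l] [Fintype m] [Fintype k] :
    Matrix l m ℝ →L[ℝ] Matrix m k ℝ →L[ℝ] Matrix l k ℝ :=
  (LinearMap.mk₂ ℝ (fun (M : Matrix l m ℝ) (N : Matrix m k ℝ) => M * N) Matrix.add_mul
    (fun c M N => Matrix.smul_mul c M N) Matrix.mul_add
    (fun c M N => Matrix.mul_smul M c N)).toContinuousBilinearMap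

@[simp]
theorem mulL_apply {l m k : Type*} [Fintype l] [Fintype m] [Fintype k] (M : Matrix l m ℝ)
    (N : Matrix m k ℝ) : mulL l m k M N = M * N := rfl

/-- The matrix-vector product as a continuous bilinear map. -/
noncomputable def mulVecL (l m : Type*) [Fintype l] [Fintype m] :
    Matrix l m ℝ →L[ℝ] (m → ℝ) →L[ℝ] (l → ℝ) :=
  (Matrix.mulVecBilin ℝ ℝ).toContinuousBilinearMap

@[simp]
theorem mulVecL_apply {l m : Type*} [Fintype l] [Fintype m] (M : Matrix l m ℝ) (v : m → ℝ) :
    mulVecL l m M v = M *ᵥ v := rfl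

variable {m : Type*} [Fintype m] [DecidableEq m] {a b : ℝ} {A U V : ℝ → Matrix m m ℝ}

/-- `U` and `V` are the fundamental matrices of the equation `z' = A z` and of the adjoint equation
`v' = -v A` on the interval between `a` and `b`, both normalized to be the identity at `a`. -/
structure IsFundamentalPair (a b : ℝ) (A U V : ℝ → Matrix m m ℝ) : Prop where
  left_eq_one : U a = 1
  isPrimitiveOn_left : IsPrimitiveOn a b U (fun t => A t * U t)
  right_eq_one : V a = 1
  isPrimitiveOn_right : IsPrimitiveOn a b V (fun t => -(V t * A t))

theorem exists_isFundamentalPair (hab : a ≤ b) (hA : IntervalIntegrable A volume a b) :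
    ∃ U V, IsFundamentalPair a b A U V := by
  obtain ⟨U, hUa, hU⟩ := exists_isPrimitiveOn_clm_apply hab (L := fun t => mulL m m m (A t))
    ⟨(mulL m m m).integrable_comp hA.1, (mulL m m m).integrable_comp hA.2⟩ 1
  obtain ⟨V, hVa, hV⟩ := exists_isPrimitiveOn_clm_apply hab (L := fun t => -(mulL m m m).flip (A t))
    ⟨((mulL m m m).flip.integrable_comp hA.1).neg,
      ((mulL m m m).flip.integrable_comp hA.2).neg⟩ 1
  exact ⟨U, V, hUa, hU, hVa, hV⟩

namespace IsFundamentalPair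

variable (h : IsFundamentalPair a b A U V)
include h

theorem right_mul_left {s : ℝ} (hs : s ∈ uIcc a b) : V s * U s = 1 := by
  have hVU := (h.isPrimitiveOn_right.clm_apply₂ (mulL m m m) h.isPrimitiveOn_left).2 s hs
  simpa [h.left_eq_one, h.right_eq_one, Matrix.mul_assoc] using hVU

theorem left_mul_right {s : ℝ} (hs : s ∈ uIcc a b) : U s * V s = 1 :=
  mul_eq_one_comm.1 (h.right_mul_left hs)

theorem eqOn_left {U' : ℝ → Matrix m m ℝ} (h' : IsFundamentalPair a b A U' V) :
    EqOn U' U (uIcc a b) := fun s hs => by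
  rw [← Matrix.inv_eq_right_inv (h.right_mul_left hs),
    Matrix.inv_eq_right_inv (h'.right_mul_left hs)]

theorem eqOn_right {V' : ℝ → Matrix m m ℝ} (h' : IsFundamentalPair a b A U V') :
    EqOn V' V (uIcc a b) := fun s hs => by
  rw [← Matrix.inv_eq_right_inv (h.left_mul_right hs),
    Matrix.inv_eq_right_inv (h'.left_mul_right hs)]

end IsFundamentalPair

end Fundamental

section Coefficient

variable {n p q : ℕ} {a b : ℝ} {r : ENNReal} {F₁ : ℝ → Matrix (Fin n) (Fin p) ℝ}
  {G₁ : ℝ → Matrix (Fin p) (Fin n) ℝ} {F₂ : ℝ → Matrix (Fin n) (Fin q) ℝ}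
  {G₂ : ℝ → Matrix (Fin q) (Fin n) ℝ}

theorem EntriesMemLp.neg {l m : Type} {M : ℝ → Matrix l m ℝ} (hM : EntriesMemLp r a b M) :
    EntriesMemLp r a b (fun s => -M s) :=
  fun i j => (hM i j).neg

theorem EntriesMemLp.rowF (hF₁ : EntriesMemLp r a b F₁) (hF₂ : EntriesMemLp r a b F₂) :
    EntriesMemLp r a b (rowF F₁ F₂) :=
  fun i j => Sum.casesOn j (hF₁ i) (hF₂ i)

theorem EntriesMemLp.colG (hG₁ : EntriesMemLp r a b G₁) (hG₂ : EntriesMemLp r a b G₂) :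
    EntriesMemLp r a b (colG G₁ G₂) :=
  fun i j => Sum.casesOn i (hG₁ · j) (hG₂.neg · j)

theorem coeff_eq_colG_mul_rowF (t : ℝ) :
    coeff F₁ G₁ F₂ G₂ t = colG G₁ G₂ t * rowF F₁ F₂ t := by
  simp only [coeff, colG, rowF, Matrix.fromRows_mul_fromCols, Matrix.neg_mul]

theorem intervalIntegrable_coeff (hab : a ≤ b) (hF₁ : EntriesMemLp 2 a b F₁)
    (hG₁ : EntriesMemLp 2 a b G₁) (hF₂ : EntriesMemLp 2 a b F₂) (hG₂ : EntriesMemLp 2 a b G₂) :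
    IntervalIntegrable (coeff F₁ G₁ F₂ G₂) volume a b := by
  rw [funext coeff_eq_colG_mul_rowF, intervalIntegrable_iff_memLp_one hab]
  exact (mulL _ _ _).memLp_of_bilin 1 (entriesMemLp_iff.1 (hG₁.colG hG₂))
    (entriesMemLp_iff.1 (hF₁.rowF hF₂))

end Coefficient

section Existence

variable {p q : ℕ} {a b : ℝ} {A U V : ℝ → Matrix (Fin p ⊕ Fin q) (Fin p ⊕ Fin q) ℝ}

theorem isFundamental_iff (hab : a ≤ b) :
    IsFundamental a b A U ↔ U a = 1 ∧ IsPrimitiveOn a b U (fun t => A t * U t) :=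
  isPrimitiveOn_matrix_one_add_iff hab

theorem isAdjointFundamental_iff (hab : a ≤ b) :
    IsAdjointFundamental a b A V ↔ V a = 1 ∧ IsPrimitiveOn a b V (fun t => -(V t * A t)) := by
  rw [← isPrimitiveOn_matrix_one_add_iff hab]
  simp only [IsAdjointFundamental, Matrix.neg_apply, intervalIntegral.integral_neg, sub_eq_add_neg]
  refine forall₂_congr fun i j => and_congr_left' ?_
  exact ⟨fun h => h.neg, fun h => by simpa only [Pi.neg_def, neg_neg] using h.neg⟩

theorem isFundamentalPair_iff (hab : a ≤ b) :
    IsFundamentalPair a b A U V ↔ IsFundamental a b A U ∧ IsAdjointFundamental a b A V := by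
  rw [isFundamental_iff hab, isAdjointFundamental_iff hab]
  exact ⟨fun h => ⟨⟨h.1, h.2⟩, h.3, h.4⟩, fun h => ⟨h.1.1, h.1.2, h.2.1, h.2.2⟩⟩

theorem exists_isFundamental (hab : a ≤ b) (hA : IntervalIntegrable A volume a b) :
    ∃ U, IsFundamental a b A U ∧ ∀ U', IsFundamental a b A U' → EqOn U' U (Icc a b) := by
  obtain ⟨U, V, h⟩ := exists_isFundamentalPair hab hA
  obtain ⟨hU, hV⟩ := (isFundamentalPair_iff hab).1 h
  exact ⟨U, hU, fun U' hU' =>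
    uIcc_of_le hab ▸ h.eqOn_left ((isFundamentalPair_iff hab).2 ⟨hU', hV⟩)⟩

theorem exists_isAdjointFundamental (hab : a ≤ b) (hA : IntervalIntegrable A volume a b) :
    ∃ V, IsAdjointFundamental a b A V ∧
      ∀ V', IsAdjointFundamental a b A V' → EqOn V' V (Icc a b) := by
  obtain ⟨U, V, h⟩ := exists_isFundamentalPair hab hA
  obtain ⟨hU, hV⟩ := (isFundamentalPair_iff hab).1 h
  exact ⟨V, hV, fun V' hV' =>
    uIcc_of_le hab ▸ h.eqOn_right ((isFundamentalPair_iff hab).2 ⟨hU, hV'⟩)⟩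

end Existence

section VariationOfConstants

variable {m : Type*} [Fintype m] [DecidableEq m] {a b : ℝ} {A U V : ℝ → Matrix m m ℝ}

namespace IsFundamentalPair

variable (h : IsFundamentalPair a b A U V) {z g : ℝ → m → ℝ}
include h

theorem intervalIntegrable_right_mulVec (hg : IntervalIntegrable g volume a b) :
    IntervalIntegrable (fun t => V t *ᵥ g t) volume a b :=
  intervalIntegrable_clm_apply₂ (mulVecL m m).flip hg h.isPrimitiveOn_right.continuousOn

theorem isPrimitiveOn_right_mulVec (hz : IsPrimitiveOn a b z (fun t => A t *ᵥ z t + g t)) :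
    IsPrimitiveOn a b (fun t => V t *ᵥ z t) (fun t => V t *ᵥ g t) := by
  refine (h.isPrimitiveOn_right.clm_apply₂ (mulVecL m m) hz).congr_ae (.of_forall fun t _ => ?_)
  simp [Matrix.mulVec_add]

theorem isPrimitiveOn_left_mulVec (hz : IsPrimitiveOn a b z (fun t => V t *ᵥ g t)) :
    IsPrimitiveOn a b (fun t => U t *ᵥ z t) (fun t => A t *ᵥ (U t *ᵥ z t) + g t) := by
  refine (h.isPrimitiveOn_left.clm_apply₂ (mulVecL m m) hz).congr_ae (.of_forall fun t ht => ?_)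
  simp [h.left_mul_right (uIoc_subset_uIcc ht), add_comm]

theorem eq_left_mulVec_add_integral (hz : IsPrimitiveOn a b z (fun t => A t *ᵥ z t + g t)) {s : ℝ}
    (hs : s ∈ uIcc a b) : z s = U s *ᵥ (z a + ∫ t in a..s, V t *ᵥ g t) := by
  have hVz : V s *ᵥ z s = z a + ∫ t in a..s, V t *ᵥ g t := by
    simpa [h.right_eq_one] using (h.isPrimitiveOn_right_mulVec hz).2 s hs
  rw [← hVz, Matrix.mulVec_mulVec, h.left_mul_right hs, Matrix.one_mulVec]

end IsFundamentalPair

end VariationOfConstants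

section TwoPoint

variable {ι κ : Type*} [Fintype ι] [Fintype κ] {a b : ℝ} {y z w : ℝ → ι ⊕ κ → ℝ}

/-- The primitive of `y` whose first block of coordinates vanishes at `a` and whose second block
vanishes at `b`. -/
noncomputable def twoPointPrimitive (a b : ℝ) (y : ℝ → ι ⊕ κ → ℝ) (s : ℝ) : ι ⊕ κ → ℝ :=
  Sum.elim (∫ t in a..s, y t ∘ Sum.inl) (∫ t in b..s, y t ∘ Sum.inr)

/-- The boundary conditions satisfied by `twoPointPrimitive`. -/
structure HasZeroBoundary (a b : ℝ) (z : ℝ → ι ⊕ κ → ℝ) : Prop where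
  left : z a ∘ Sum.inl = 0
  right : z b ∘ Sum.inr = 0

theorem hasZeroBoundary_twoPointPrimitive : HasZeroBoundary a b (twoPointPrimitive a b y) := by
  constructor <;> simp [twoPointPrimitive]

theorem eqOn_twoPointPrimitive_of_ae_eq (hyw : ∀ᵐ t, t ∈ uIoc a b → y t = w t) :
    EqOn (twoPointPrimitive a b y) (twoPointPrimitive a b w) (uIcc a b) := by
  have hae {c s : ℝ} (hc : c ∈ uIcc a b) (hs : s ∈ uIcc a b) : ∀ᵐ t, t ∈ uIoc c s → y t = w t :=
    hyw.mono fun t ht hts =>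
      ht (uIoc_subset_uIoc_of_uIcc_subset_uIcc (uIcc_subset_uIcc hc hs) hts)
  exact fun s hs => congrArg₂ Sum.elim
    (intervalIntegral.integral_congr_ae <| (hae left_mem_uIcc hs).mono fun t ht hts =>
      congrArg (· ∘ Sum.inl) (ht hts))
    (intervalIntegral.integral_congr_ae <| (hae right_mem_uIcc hs).mono fun t ht hts =>
      congrArg (· ∘ Sum.inr) (ht hts))

theorem isPrimitiveOn_twoPointPrimitive (hy : IntervalIntegrable y volume a b) :
    IsPrimitiveOn a b (twoPointPrimitive a b y) y := by
  have hcoord := isPrimitiveOn_pi_iff.1 (isPrimitiveOn_integral hy left_mem_uIcc)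
  have hinl : IntervalIntegrable (fun t => y t ∘ Sum.inl) volume a b :=
    (isPrimitiveOn_pi_iff.2 fun i => hcoord (Sum.inl i)).1
  have hinr : IntervalIntegrable (fun t => y t ∘ Sum.inr) volume a b :=
    (isPrimitiveOn_pi_iff.2 fun i => hcoord (Sum.inr i)).1
  exact (isPrimitiveOn_sum_elim_iff.2 ⟨isPrimitiveOn_integral hinl left_mem_uIcc,
    isPrimitiveOn_integral hinr right_mem_uIcc⟩).congr_ae
      (.of_forall fun t _ => Sum.elim_comp_inl_inr (y t))

theorem HasZeroBoundary.eqOn (hz : HasZeroBoundary a b z) (hw : HasZeroBoundary a b w)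
    (hzy : IsPrimitiveOn a b z y) (hwy : IsPrimitiveOn a b w y) : EqOn z w (uIcc a b) :=
  fun s hs => by
    have hinl : ∀ i, z a (Sum.inl i) = w a (Sum.inl i) := congrFun (hz.left.trans hw.left.symm)
    have hinr : ∀ j, z b (Sum.inr j) = w b (Sum.inr j) := congrFun (hz.right.trans hw.right.symm)
    ext (i | j)
    · have hi := congrFun (hzy.sub_eq_sub hwy left_mem_uIcc hs) (Sum.inl i)
      rwa [Pi.sub_apply, Pi.sub_apply, hinl i, sub_left_inj] at hi
    · have hj := congrFun (hzy.sub_eq_sub hwy right_mem_uIcc hs) (Sum.inr j)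
      rwa [Pi.sub_apply, Pi.sub_apply, hinr j, sub_left_inj] at hj

end TwoPoint

section ClosedLoop

variable {p q : ℕ}

theorem mulVec_comp_inr (M : Matrix (Fin p ⊕ Fin q) (Fin p ⊕ Fin q) ℝ) (v : Fin p ⊕ Fin q → ℝ) :
    (M *ᵥ v) ∘ Sum.inr = M.toBlocks₂₁ *ᵥ (v ∘ Sum.inl) + M.toBlocks₂₂ *ᵥ (v ∘ Sum.inr) := by
  conv_lhs => rw [← M.fromBlocks_toBlocks, Matrix.fromBlocks_mulVec, Sum.elim_comp_inr]

theorem eq_neg_projP_mulVec_iff {M : Matrix (Fin p ⊕ Fin q) (Fin p ⊕ Fin q) ℝ}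
    (hM : IsUnit M.toBlocks₂₂) {v w : Fin p ⊕ Fin q → ℝ} :
    v = -(projP M *ᵥ w) ↔ v ∘ Sum.inl = 0 ∧ (M *ᵥ (v + w)) ∘ Sum.inr = 0 := by
  have hsplit : v + projP M *ᵥ w = Sum.elim (v ∘ Sum.inl) (v ∘ Sum.inr +
      (M.toBlocks₂₂⁻¹ *ᵥ (M.toBlocks₂₁ *ᵥ (w ∘ Sum.inl)) + w ∘ Sum.inr)) := by
    ext (i | j) <;> simp [projP, Matrix.fromBlocks_mulVec]
  have hsolve : v ∘ Sum.inl = 0 → (M *ᵥ (v + w)) ∘ Sum.inr = M.toBlocks₂₂ *ᵥ (v ∘ Sum.inr +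
      (M.toBlocks₂₂⁻¹ *ᵥ (M.toBlocks₂₁ *ᵥ (w ∘ Sum.inl)) + w ∘ Sum.inr)) := fun hv => by
    rw [mulVec_comp_inr, Pi.add_comp, Pi.add_comp, hv, zero_add, Matrix.mulVec_add,
      Matrix.mulVec_add, Matrix.mulVec_add, Matrix.mulVec_mulVec,
      Matrix.mul_nonsing_inv _ ((Matrix.isUnit_iff_isUnit_det _).1 hM), Matrix.one_mulVec]
    abel
  rw [eq_neg_iff_add_eq_zero, hsplit, ← Sum.elim_zero_zero, Sum.elim_eq_iff]
  refine and_congr_right fun hv => ?_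
  rw [hsolve hv]
  exact ((Matrix.mulVec_injective_of_isUnit hM).eq_iff' (Matrix.mulVec_zero _)).symm

variable {a b : ℝ} {A U V : ℝ → Matrix (Fin p ⊕ Fin q) (Fin p ⊕ Fin q) ℝ}
  {g z : ℝ → Fin p ⊕ Fin q → ℝ}

/-- The solution of the boundary value problem `z' = A z + g`, `z₁(a) = 0`, `z₂(b) = 0`, in terms of
the fundamental matrices `U` and `V` of `A`. -/
noncomputable def closedLoop (a b : ℝ) (U V : ℝ → Matrix (Fin p ⊕ Fin q) (Fin p ⊕ Fin q) ℝ)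
    (g : ℝ → Fin p ⊕ Fin q → ℝ) (s : ℝ) : Fin p ⊕ Fin q → ℝ :=
  U s *ᵥ (-(projP (U b) *ᵥ ∫ t in a..b, V t *ᵥ g t) + ∫ t in a..s, V t *ᵥ g t)

namespace IsFundamentalPair

variable (h : IsFundamentalPair a b A U V)
include h

theorem hasZeroBoundary_left_mulVec_iff (hU : IsUnit (U b).toBlocks₂₂) {v : Fin p ⊕ Fin q → ℝ} :
    HasZeroBoundary a b (fun s => U s *ᵥ (v + ∫ t in a..s, V t *ᵥ g t)) ↔
      v = -(projP (U b) *ᵥ ∫ t in a..b, V t *ᵥ g t) := by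
  rw [eq_neg_projP_mulVec_iff hU]
  constructor
  · exact fun hv => ⟨by simpa [h.left_eq_one] using hv.left, hv.right⟩
  · exact fun hv => ⟨by simpa [h.left_eq_one] using hv.1, hv.2⟩

theorem hasZeroBoundary_closedLoop (hU : IsUnit (U b).toBlocks₂₂) :
    HasZeroBoundary a b (closedLoop a b U V g) :=
  (h.hasZeroBoundary_left_mulVec_iff hU).2 rfl

theorem isPrimitiveOn_closedLoop (hg : IntervalIntegrable g volume a b) :
    IsPrimitiveOn a b (closedLoop a b U V g) (fun t => A t *ᵥ closedLoop a b U V g t + g t) :=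
  h.isPrimitiveOn_left_mulVec ((isPrimitiveOn_integral (h.intervalIntegrable_right_mulVec hg)
    left_mem_uIcc).const_add _)

theorem eqOn_closedLoop (hU : IsUnit (U b).toBlocks₂₂) (hz₀ : HasZeroBoundary a b z)
    (hz : IsPrimitiveOn a b z (fun t => A t *ᵥ z t + g t)) :
    EqOn z (closedLoop a b U V g) (uIcc a b) := by
  have hformula : ∀ s ∈ uIcc a b, z s = U s *ᵥ (z a + ∫ t in a..s, V t *ᵥ g t) :=
    fun s hs => h.eq_left_mulVec_add_integral hz hs
  have hza : z a = -(projP (U b) *ᵥ ∫ t in a..b, V t *ᵥ g t) := by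
    refine (h.hasZeroBoundary_left_mulVec_iff hU).1 ⟨?_, ?_⟩
    · simpa only [← hformula a left_mem_uIcc] using hz₀.left
    · simpa only [← hformula b right_mem_uIcc] using hz₀.right
  exact fun s hs => by rw [closedLoop, ← hza, hformula s hs]

end IsFundamentalPair

end ClosedLoop

section Feedback

variable {n : Type*} [Fintype n] {p q : ℕ} {a b : ℝ}
  {B : ℝ → Matrix (Fin p ⊕ Fin q) n ℝ} {C : ℝ → Matrix n (Fin p ⊕ Fin q) ℝ}
  {U V : ℝ → Matrix (Fin p ⊕ Fin q) (Fin p ⊕ Fin q) ℝ} {x y : ℝ → n → ℝ}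

theorem IsFundamentalPair.eqOn_twoPointPrimitive_of_open
    (h : IsFundamentalPair a b (fun t => B t * C t) U V) (hU : IsUnit (U b).toBlocks₂₂)
    (hBx : IntervalIntegrable (fun t => B t *ᵥ x t) volume a b)
    (hxy : ∀ᵐ t, t ∈ uIoc a b → y t = x t - C t *ᵥ twoPointPrimitive a b (fun t => B t *ᵥ x t) t) :
    EqOn (twoPointPrimitive a b (fun t => B t *ᵥ x t))
      (closedLoop a b U V fun t => B t *ᵥ y t) (uIcc a b) := by
  refine h.eqOn_closedLoop hU hasZeroBoundary_twoPointPrimitive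
    ((isPrimitiveOn_twoPointPrimitive hBx).congr_ae ?_)
  filter_upwards [hxy] with t ht hts
  rw [ht hts, Matrix.mulVec_sub, Matrix.mulVec_mulVec, add_sub_cancel]

theorem IsFundamentalPair.eqOn_twoPointPrimitive_of_closed
    (h : IsFundamentalPair a b (fun t => B t * C t) U V) (hU : IsUnit (U b).toBlocks₂₂)
    (hBy : IntervalIntegrable (fun t => B t *ᵥ y t) volume a b)
    (hxy : ∀ᵐ t, t ∈ uIoc a b → x t = y t + C t *ᵥ closedLoop a b U V (fun t => B t *ᵥ y t) t) :
    EqOn (twoPointPrimitive a b (fun t => B t *ᵥ x t))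
      (closedLoop a b U V fun t => B t *ᵥ y t) (uIcc a b) := by
  have hprim : IsPrimitiveOn a b (closedLoop a b U V fun t => B t *ᵥ y t) fun t => B t *ᵥ x t := by
    refine (h.isPrimitiveOn_closedLoop hBy).congr_ae ?_
    filter_upwards [hxy] with t ht hts
    rw [ht hts, Matrix.mulVec_add, Matrix.mulVec_mulVec, add_comm]
  exact hasZeroBoundary_twoPointPrimitive.eqOn (h.hasZeroBoundary_closedLoop hU)
    (isPrimitiveOn_twoPointPrimitive hprim.1) hprim

theorem IsFundamentalPair.ae_eq_sub_twoPointPrimitive_iff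
    (h : IsFundamentalPair a b (fun t => B t * C t) U V) (hU : IsUnit (U b).toBlocks₂₂)
    (hBx : IntervalIntegrable (fun t => B t *ᵥ x t) volume a b)
    (hBy : IntervalIntegrable (fun t => B t *ᵥ y t) volume a b) :
    (∀ᵐ t, t ∈ uIoc a b → y t = x t - C t *ᵥ twoPointPrimitive a b (fun t => B t *ᵥ x t) t) ↔
      ∀ᵐ t, t ∈ uIoc a b → x t = y t + C t *ᵥ closedLoop a b U V (fun t => B t *ᵥ y t) t := by
  constructor <;> intro hxy
  · filter_upwards [hxy] with t ht hts
    rw [ht hts, ← h.eqOn_twoPointPrimitive_of_open hU hBx hxy (uIoc_subset_uIcc hts),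
      sub_add_cancel]
  · filter_upwards [hxy] with t ht hts
    rw [ht hts, h.eqOn_twoPointPrimitive_of_closed hU hBy hxy (uIoc_subset_uIcc hts),
      add_sub_cancel_right]

theorem IsFundamentalPair.exists_eqOn_twoPointPrimitive_of_not_isUnit
    {A : ℝ → Matrix (Fin p ⊕ Fin q) (Fin p ⊕ Fin q) ℝ} (h : IsFundamentalPair a b A U V)
    (hU : ¬IsUnit (U b).toBlocks₂₂) :
    ∃ z : ℝ → Fin p ⊕ Fin q → ℝ, z a ≠ 0 ∧ ContinuousOn z (uIcc a b) ∧
      EqOn z (twoPointPrimitive a b fun t => A t *ᵥ z t) (uIcc a b) := by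
  obtain ⟨c, hc, hUc⟩ : ∃ c ≠ 0, (U b).toBlocks₂₂ *ᵥ c = 0 := by
    rwa [Matrix.exists_mulVec_eq_zero_iff, ← not_ne_iff, ← isUnit_iff_ne_zero,
      ← Matrix.isUnit_iff_isUnit_det]
  set v : Fin p ⊕ Fin q → ℝ := Sum.elim 0 c
  have hprim : IsPrimitiveOn a b (fun s => U s *ᵥ v) (fun t => A t *ᵥ (U t *ᵥ v)) :=
    (h.isPrimitiveOn_left.clm_comp ((mulVecL (Fin p ⊕ Fin q) (Fin p ⊕ Fin q)).flip v)).congr_ae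
      (.of_forall fun t _ => (Matrix.mulVec_mulVec v (A t) (U t)).symm)
  have hzero : HasZeroBoundary a b (fun s => U s *ᵥ v) :=
    ⟨by simp [h.left_eq_one, v], by simp [mulVec_comp_inr, v, hUc]⟩
  refine ⟨fun s => U s *ᵥ v, fun (hva : U a *ᵥ v = 0) => hc ?_, hprim.continuousOn,
    hzero.eqOn hasZeroBoundary_twoPointPrimitive hprim (isPrimitiveOn_twoPointPrimitive hprim.1)⟩
  rw [h.left_eq_one, Matrix.one_mulVec, ← Sum.elim_zero_zero, Sum.elim_eq_iff] at hva
  exact hva.2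

end Feedback

section Operators

theorem exists_mulCLM {α E F G : Type*} [MeasurableSpace α] {μ : Measure α} [NormedAddCommGroup E]
    [NormedSpace ℝ E] [NormedAddCommGroup F] [NormedSpace ℝ F] [NormedAddCommGroup G]
    [NormedSpace ℝ G] {p q : ENNReal} (r : ENNReal) [p.HolderTriple q r] [Fact (1 ≤ p)]
    [Fact (1 ≤ q)] [Fact (1 ≤ r)] (B : E →L[ℝ] F →L[ℝ] G) {f : α → E} (hf : MemLp f p μ) :
    ∃ K : Lp F q μ →L[ℝ] Lp G r μ, ∀ x, K x =ᵐ[μ] fun s => B (f s) (x s) := by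
  refine ⟨B.holderL μ p q r (hf.toLp f), fun x => ?_⟩
  rw [ContinuousLinearMap.holderL_apply_apply]
  filter_upwards [B.coeFn_holder (r := r) (hf.toLp f) x, hf.coeFn_toLp] with s hs hfs
  rw [hs, hfs]

theorem intervalIntegrable_coeFn {E : Type*} [NormedAddCommGroup E] {a b : ℝ} (hab : a ≤ b)
    (y : Lp E 1 (volume.restrict (Icc a b))) : IntervalIntegrable y volume a b :=
  (intervalIntegrable_iff_integrableOn_Icc_of_le hab).2 (L1.integrable_coeFn y)

variable {E : Type*} [NormedAddCommGroup E] [NormedSpace ℝ E] {a b c : ℝ}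

theorem integral_congr_ae_Icc {f g : ℝ → E}
    (hfg : f =ᵐ[volume.restrict (Icc a b)] g) {s : ℝ} (hc : c ∈ Icc a b) (hs : s ∈ Icc a b) :
    ∫ t in c..s, f t = ∫ t in c..s, g t :=
  intervalIntegral.integral_congr_ae_restrict <| ae_restrict_of_ae_restrict_of_subset
    (uIoc_subset_uIcc.trans (ordConnected_Icc.uIcc_subset hc hs)) hfg

theorem norm_integral_coeFn_le (y : Lp E 1 (volume.restrict (Icc a b))) {s : ℝ} (hc : c ∈ Icc a b)
    (hs : s ∈ Icc a b) : ‖∫ t in c..s, y t‖ ≤ ‖y‖ := by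
  rw [L1.norm_eq_integral_norm]
  refine intervalIntegral.norm_integral_le_integral_norm_uIoc.trans
    (setIntegral_mono_set (L1.integrable_coeFn y).norm (.of_forall fun _ => norm_nonneg _) ?_)
  exact (uIoc_subset_uIcc.trans (ordConnected_Icc.uIcc_subset hc hs)).eventuallyLE

theorem exists_primitiveCLM [CompleteSpace E] (hc : c ∈ Icc a b) :
    ∃ J : Lp E 1 (volume.restrict (Icc a b)) →L[ℝ] Lp E ⊤ (volume.restrict (Icc a b)),
      ∀ y, J y =ᵐ[volume.restrict (Icc a b)] fun s => ∫ t in c..s, y t := by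
  have hab : a ≤ b := hc.1.trans hc.2
  have hint (y : Lp E 1 (volume.restrict (Icc a b))) {s : ℝ} (hs : s ∈ Icc a b) :
      IntervalIntegrable y volume c s := by
    rw [← uIcc_of_le hab] at hc hs
    exact intervalIntegrable_of_mem_uIcc (intervalIntegrable_coeFn hab y) hc hs
  have hmem (y : Lp E 1 (volume.restrict (Icc a b))) :
      MemLp (fun s => ∫ t in c..s, y t) ⊤ (volume.restrict (Icc a b)) := by
    refine memLp_top_of_continuousOn ?_
    simpa only [uIcc_of_le hab] using (isPrimitiveOn_integral (intervalIntegrable_coeFn hab y)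
      (uIcc_of_le hab ▸ hc)).continuousOn
  refine ⟨LinearMap.mkContinuous
    { toFun := fun y => (hmem y).toLp
      map_add' := fun y z => ?_
      map_smul' := fun r y => ?_ } 1 fun y => ?_, fun y => (hmem y).coeFn_toLp⟩
  · rw [← MemLp.toLp_add, MemLp.toLp_eq_toLp_iff]
    exact ae_restrict_of_forall_mem measurableSet_Icc fun s hs =>
      (integral_congr_ae_Icc (Lp.coeFn_add y z) hc hs).trans
        (intervalIntegral.integral_add (hint y hs) (hint z hs))
  · rw [RingHom.id_apply, ← MemLp.toLp_const_smul, MemLp.toLp_eq_toLp_iff]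
    exact ae_restrict_of_forall_mem measurableSet_Icc fun s hs =>
      (integral_congr_ae_Icc (Lp.coeFn_smul r y) hc hs).trans
        (intervalIntegral.integral_smul r (y : ℝ → E))
  · refine (Lp.norm_le_of_ae_bound (norm_nonneg y) ?_).trans_eq (by simp)
    filter_upwards [(hmem y).coeFn_toLp, ae_restrict_mem measurableSet_Icc] with s hys hs
    exact (congrArg norm hys).trans_le (norm_integral_coeFn_le y hc hs)

theorem EntriesMemLp.mul {l m k : Type} [Fintype m] {M : ℝ → Matrix l m ℝ} {N : ℝ → Matrix m k ℝ}
    {p q : ENNReal} (r : ENNReal) [p.HolderTriple q r] (hM : EntriesMemLp p a b M)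
    (hN : EntriesMemLp q a b N) : EntriesMemLp r a b (fun s => M s * N s) := fun i j => by
  simp only [Matrix.mul_apply]
  exact memLp_finsetSum _ fun x _ => (hN x j).mul (hM i x)

variable {l m k : Type} [Fintype l] [Fintype m] [Fintype k]

theorem entriesMemLp_top_of_continuousOn {M : ℝ → Matrix l m ℝ} (hM : ContinuousOn M (Icc a b)) :
    EntriesMemLp ⊤ a b M :=
  entriesMemLp_iff.2 (memLp_top_of_continuousOn hM)

theorem exists_integralCLM {F : ℝ → Matrix l m ℝ} {G : ℝ → Matrix m k ℝ}
    (hF : EntriesMemLp 2 a b F) (hG : EntriesMemLp 2 a b G) (hc : c ∈ Icc a b) :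
    ∃ K : Lp (k → ℝ) 2 (volume.restrict (Icc a b)) →L[ℝ] Lp (l → ℝ) 2 (volume.restrict (Icc a b)),
      ∀ x, ∀ᵐ s ∂volume.restrict (Icc a b), K x s = F s *ᵥ ∫ t in c..s, G t *ᵥ x t := by
  obtain ⟨KG, hKG⟩ := exists_mulCLM (q := 2) 1 (mulVecL m k) (entriesMemLp_iff.1 hG)
  obtain ⟨J, hJ⟩ := exists_primitiveCLM (E := m → ℝ) hc
  obtain ⟨KF, hKF⟩ := exists_mulCLM (q := ⊤) 2 (mulVecL l m) (entriesMemLp_iff.1 hF)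
  refine ⟨KF ∘L J ∘L KG, fun x => ?_⟩
  filter_upwards [hKF (J (KG x)), hJ (KG x), ae_restrict_mem measurableSet_Icc] with s hFs hJs hs
  rw [ContinuousLinearMap.comp_apply, ContinuousLinearMap.comp_apply, hFs, hJs,
    integral_congr_ae_Icc (hKG x) hc hs]
  simp only [mulVecL_apply]

end Operators

section Separable

variable {n : ℕ} {ι κ : Type} [Fintype ι] [Fintype κ] {a b : ℝ}

theorem memLp_ofLp (x : L2 n a b) : MemLp (fun t => (x t).ofLp) 2 (volume.restrict (Icc a b)) :=
  (PiLp.continuousLinearEquiv 2 ℝ fun _ : Fin n => ℝ).toContinuousLinearMap.comp_memLp' (Lp.memLp x)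

theorem intervalIntegrable_mulVec_ofLp (hab : a ≤ b) {G : ℝ → Matrix ι (Fin n) ℝ}
    (hG : EntriesMemLp 2 a b G) (x : L2 n a b) :
    IntervalIntegrable (fun t => G t *ᵥ (x t).ofLp) volume a b :=
  (intervalIntegrable_iff_memLp_one hab).2
    ((mulVecL ι (Fin n)).memLp_of_bilin 1 (entriesMemLp_iff.1 hG) (memLp_ofLp x))

theorem intervalIntegrable_and_integral_act_mul {F : Matrix (Fin n) ι ℝ}
    {G : ℝ → Matrix ι (Fin n) ℝ} {K : ℝ → Matrix (Fin n) (Fin n) ℝ}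
    {x : ℝ → EuclideanSpace ℝ (Fin n)} {c d : ℝ} (hK : ∀ t ∈ uIoc c d, K t = F * G t)
    (hGx : IntervalIntegrable (fun t => G t *ᵥ (x t).ofLp) volume c d) :
    IntervalIntegrable (fun t => act (K t) (x t)) volume c d ∧
      ∫ t in c..d, act (K t) (x t) = WithLp.toLp 2 (F *ᵥ ∫ t in c..d, G t *ᵥ (x t).ofLp) := by
  let Φ : (ι → ℝ) →L[ℝ] EuclideanSpace ℝ (Fin n) :=
    (PiLp.continuousLinearEquiv 2 ℝ _).symm.toContinuousLinearMap ∘L mulVecL (Fin n) ι F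
  have hact : EqOn (fun t => Φ (G t *ᵥ (x t).ofLp)) (fun t => act (K t) (x t)) (uIoc c d) :=
    fun t ht => by simp [Φ, act, hK t ht]
  refine ⟨IntervalIntegrable.congr hact ⟨Φ.integrable_comp hGx.1, Φ.integrable_comp hGx.2⟩, ?_⟩
  rw [← intervalIntegral.integral_congr_ae (.of_forall hact)]
  exact Φ.intervalIntegral_comp_comm hGx

theorem isThreePI_iff_of_separable (hab : a ≤ b) {M : ℝ → Matrix (Fin n) (Fin n) ℝ}
    {R₁ R₂ : ℝ → ℝ → Matrix (Fin n) (Fin n) ℝ} {F₁ : ℝ → Matrix (Fin n) ι ℝ}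
    {G₁ : ℝ → Matrix ι (Fin n) ℝ} {F₂ : ℝ → Matrix (Fin n) κ ℝ} {G₂ : ℝ → Matrix κ (Fin n) ℝ}
    (hG₁ : EntriesMemLp 2 a b G₁) (hG₂ : EntriesMemLp 2 a b G₂)
    (hR₁ : ∀ s ∈ Icc a b, ∀ θ ∈ Icc a b, R₁ s θ = F₁ s * G₁ θ)
    (hR₂ : ∀ s ∈ Icc a b, ∀ θ ∈ Icc a b, R₂ s θ = F₂ s * G₂ θ) {T : L2 n a b →L[ℝ] L2 n a b} :
    IsThreePI M R₁ R₂ T ↔ ∀ x, ∀ᵐ s ∂volume.restrict (Icc a b), (T x s).ofLp =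
      M s *ᵥ (x s).ofLp + F₁ s *ᵥ (∫ t in a..s, G₁ t *ᵥ (x t).ofLp) -
        F₂ s *ᵥ ∫ t in b..s, G₂ t *ᵥ (x t).ofLp := by
  refine forall_congr' fun x => Filter.eventually_congr ?_
  refine ae_restrict_of_forall_mem measurableSet_Icc fun s hs => ?_
  have hsub₁ : uIoc a s ⊆ Icc a b :=
    uIoc_subset_uIcc.trans (ordConnected_Icc.uIcc_subset (left_mem_Icc.2 hab) hs)
  have hsub₂ : uIoc s b ⊆ Icc a b :=
    uIoc_subset_uIcc.trans (ordConnected_Icc.uIcc_subset hs (right_mem_Icc.2 hab))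
  have hs' : s ∈ uIcc a b := uIcc_of_le hab ▸ hs
  obtain ⟨hint₁, heq₁⟩ := intervalIntegrable_and_integral_act_mul
    (fun t ht => hR₁ s hs t (hsub₁ ht)) (intervalIntegrable_of_mem_uIcc
      (intervalIntegrable_mulVec_ofLp hab hG₁ x) left_mem_uIcc hs')
  obtain ⟨hint₂, heq₂⟩ := intervalIntegrable_and_integral_act_mul
    (fun t ht => hR₂ s hs t (hsub₂ ht)) (intervalIntegrable_of_mem_uIcc
      (intervalIntegrable_mulVec_ofLp hab hG₂ x) hs' right_mem_uIcc)
  rw [and_iff_right hint₁, and_iff_right hint₂, heq₁, heq₂, intervalIntegral.integral_symm b s,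
    Matrix.mulVec_neg, ← (WithLp.ofLp_injective 2).eq_iff]
  simp only [act, WithLp.ofLp_add, sub_eq_add_neg]

theorem exists_isThreePI_of_separable (hab : a ≤ b) {M : ℝ → Matrix (Fin n) (Fin n) ℝ}
    {R₁ R₂ : ℝ → ℝ → Matrix (Fin n) (Fin n) ℝ} {F₁ : ℝ → Matrix (Fin n) ι ℝ}
    {G₁ : ℝ → Matrix ι (Fin n) ℝ} {F₂ : ℝ → Matrix (Fin n) κ ℝ} {G₂ : ℝ → Matrix κ (Fin n) ℝ}
    (hM : EntriesMemLp ⊤ a b M) (hF₁ : EntriesMemLp 2 a b F₁) (hG₁ : EntriesMemLp 2 a b G₁)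
    (hF₂ : EntriesMemLp 2 a b F₂) (hG₂ : EntriesMemLp 2 a b G₂)
    (hR₁ : ∀ s ∈ Icc a b, ∀ θ ∈ Icc a b, R₁ s θ = F₁ s * G₁ θ)
    (hR₂ : ∀ s ∈ Icc a b, ∀ θ ∈ Icc a b, R₂ s θ = F₂ s * G₂ θ) :
    ∃ T : L2 n a b →L[ℝ] L2 n a b, IsThreePI M R₁ R₂ T := by
  simp only [isThreePI_iff_of_separable hab hG₁ hG₂ hR₁ hR₂]
  obtain ⟨K₀, hK₀⟩ := exists_mulCLM (q := 2) 2 (mulVecL (Fin n) (Fin n)) (entriesMemLp_iff.1 hM)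
  obtain ⟨K₁, hK₁⟩ := exists_integralCLM hF₁ hG₁ (left_mem_Icc.2 hab)
  obtain ⟨K₂, hK₂⟩ := exists_integralCLM hF₂ hG₂ (right_mem_Icc.2 hab)
  let e : EuclideanSpace ℝ (Fin n) ≃L[ℝ] (Fin n → ℝ) := PiLp.continuousLinearEquiv 2 ℝ _
  refine ⟨e.symm.toContinuousLinearMap.compLpL 2 _ ∘L (K₀ + K₁ - K₂) ∘L
    e.toContinuousLinearMap.compLpL 2 _, fun x => ?_⟩
  set y := e.toContinuousLinearMap.compLpL 2 (volume.restrict (Icc a b)) x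
  have hyx : y =ᵐ[volume.restrict (Icc a b)] fun t => (x t).ofLp :=
    e.toContinuousLinearMap.coeFn_compLpL x
  filter_upwards [e.symm.toContinuousLinearMap.coeFn_compLpL ((K₀ + K₁ - K₂) y),
    Lp.coeFn_sub (K₀ y + K₁ y) (K₂ y), Lp.coeFn_add (K₀ y) (K₁ y), hK₀ y, hK₁ y, hK₂ y, hyx,
    ae_restrict_mem measurableSet_Icc] with s hT hsub hadd h₀ h₁ h₂ hys hs
  have hy₁ : ∫ t in a..s, G₁ t *ᵥ y t = ∫ t in a..s, G₁ t *ᵥ (x t).ofLp :=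
    integral_congr_ae_Icc (hyx.mono fun t ht => congrArg (G₁ t *ᵥ ·) ht) (left_mem_Icc.2 hab) hs
  have hy₂ : ∫ t in b..s, G₂ t *ᵥ y t = ∫ t in b..s, G₂ t *ᵥ (x t).ofLp :=
    integral_congr_ae_Icc (hyx.mono fun t ht => congrArg (G₂ t *ᵥ ·) ht) (right_mem_Icc.2 hab) hs
  calc _ = (K₀ y + K₁ y - K₂ y) s := congrArg WithLp.ofLp hT
    _ = _ := by
      rw [hsub, Pi.sub_apply, hadd, Pi.add_apply, h₀, h₁, h₂, hys, mulVecL_apply, hy₁, hy₂]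

end Separable

section Formulas

variable {n p q : ℕ} {a b : ℝ} {R₀ : ℝ → Matrix (Fin n) (Fin n) ℝ}
  {R₁ R₂ : ℝ → ℝ → Matrix (Fin n) (Fin n) ℝ} {F₁ : ℝ → Matrix (Fin n) (Fin p) ℝ}
  {G₁ : ℝ → Matrix (Fin p) (Fin n) ℝ} {F₂ : ℝ → Matrix (Fin n) (Fin q) ℝ}
  {G₂ : ℝ → Matrix (Fin q) (Fin n) ℝ} {A U V : ℝ → Matrix (Fin p ⊕ Fin q) (Fin p ⊕ Fin q) ℝ}
  {T S : L2 n a b →L[ℝ] L2 n a b}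

theorem rowF_mulVec_twoPointPrimitive_colG (x : ℝ → Fin n → ℝ) (s : ℝ) :
    rowF F₁ F₂ s *ᵥ twoPointPrimitive a b (fun t => colG G₁ G₂ t *ᵥ x t) s =
      F₁ s *ᵥ (∫ t in a..s, G₁ t *ᵥ x t) - F₂ s *ᵥ ∫ t in b..s, G₂ t *ᵥ x t := by
  simp only [rowF, colG, twoPointPrimitive, Matrix.fromCols_mulVec_sumElim, Matrix.fromRows_mulVec,
    Sum.elim_comp_inl, Sum.elim_comp_inr, Matrix.neg_mulVec, intervalIntegral.integral_neg,
    Matrix.mulVec_neg, sub_eq_add_neg]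

theorem isThreePI_iff_twoPointPrimitive (hab : a ≤ b) (hG₁ : EntriesMemLp 2 a b G₁)
    (hG₂ : EntriesMemLp 2 a b G₂)
    (hR₁ : ∀ s ∈ Icc a b, ∀ θ ∈ Icc a b, R₁ s θ = -(R₀ s * F₁ s) * G₁ θ)
    (hR₂ : ∀ s ∈ Icc a b, ∀ θ ∈ Icc a b, R₂ s θ = -(R₀ s * F₂ s) * G₂ θ) :
    IsThreePI R₀ R₁ R₂ T ↔ ∀ x, ∀ᵐ s ∂volume.restrict (Icc a b), (T x s).ofLp =
      R₀ s *ᵥ ((x s).ofLp - rowF F₁ F₂ s *ᵥ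
        twoPointPrimitive a b (fun t => colG G₁ G₂ t *ᵥ (x t).ofLp) s) := by
  rw [isThreePI_iff_of_separable hab hG₁ hG₂ hR₁ hR₂]
  refine forall_congr' fun x => Filter.eventually_congr (.of_forall fun s => ?_)
  rw [rowF_mulVec_twoPointPrimitive_colG, Matrix.mulVec_sub, Matrix.mulVec_sub,
    Matrix.mulVec_mulVec, Matrix.mulVec_mulVec, Matrix.neg_mulVec, Matrix.neg_mulVec]
  exact iff_of_eq (congrArg _ (by abel))

theorem kerL₂_mul (b : ℝ) (M : Matrix (Fin n) (Fin n) ℝ) (s θ : ℝ) :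
    kerL₂ b F₁ G₁ F₂ G₂ U V s θ * M =
      -(rowF F₁ F₂ s * (U s * projP (U b))) * (V θ * (colG G₁ G₂ θ * M)) := by
  simp only [kerL₂, Matrix.neg_mul, Matrix.mul_assoc]

theorem kerL₁_mul (b : ℝ) (M : Matrix (Fin n) (Fin n) ℝ) (s θ : ℝ) :
    kerL₁ b F₁ G₁ F₂ G₂ U V s θ * M =
      rowF F₁ F₂ s * (U s * (1 - projP (U b))) * (V θ * (colG G₁ G₂ θ * M)) := by
  simp only [kerL₁, kerL₂, Matrix.add_mul, Matrix.neg_mul, Matrix.mul_assoc, Matrix.mul_add,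
    Matrix.mul_neg, Matrix.one_mul, sub_eq_add_neg]

theorem closedLoop_eq_add {g : ℝ → Fin p ⊕ Fin q → ℝ} {s : ℝ} (hs : s ∈ uIcc a b)
    (hVg : IntervalIntegrable (fun t => V t *ᵥ g t) volume a b) :
    closedLoop a b U V g s = (U s * (1 - projP (U b))) *ᵥ (∫ t in a..s, V t *ᵥ g t) +
      (U s * projP (U b)) *ᵥ ∫ t in b..s, V t *ᵥ g t := by
  have hsplit : ∫ t in a..b, V t *ᵥ g t =
      (∫ t in a..s, V t *ᵥ g t) - ∫ t in b..s, V t *ᵥ g t := by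
    rw [eq_sub_iff_add_eq, intervalIntegral.integral_add_adjacent_intervals hVg
      (intervalIntegrable_of_mem_uIcc hVg right_mem_uIcc hs)]
  rw [closedLoop, hsplit, ← Matrix.mulVec_mulVec, ← Matrix.mulVec_mulVec, ← Matrix.mulVec_add,
    Matrix.sub_mulVec, Matrix.one_mulVec, Matrix.mulVec_sub]
  exact congrArg _ (by abel)

namespace IsFundamentalPair

variable (h : IsFundamentalPair a b A U V)
include h

theorem entriesMemLp_left (hab : a ≤ b) : EntriesMemLp ⊤ a b U :=
  entriesMemLp_top_of_continuousOn (uIcc_of_le hab ▸ h.isPrimitiveOn_left.continuousOn)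

theorem entriesMemLp_right (hab : a ≤ b) : EntriesMemLp ⊤ a b V :=
  entriesMemLp_top_of_continuousOn (uIcc_of_le hab ▸ h.isPrimitiveOn_right.continuousOn)

theorem entriesMemLp_right_mul (hab : a ≤ b) (hR₀inv : EntriesMemLp ⊤ a b (fun s => (R₀ s)⁻¹))
    (hG₁ : EntriesMemLp 2 a b G₁) (hG₂ : EntriesMemLp 2 a b G₂) :
    EntriesMemLp 2 a b (fun t => V t * (colG G₁ G₂ t * (R₀ t)⁻¹)) :=
  (h.entriesMemLp_right hab).mul 2 ((hG₁.colG hG₂).mul 2 hR₀inv)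

theorem isThreePI_iff_closedLoop (hab : a ≤ b) (hR₀inv : EntriesMemLp ⊤ a b (fun s => (R₀ s)⁻¹))
    (hG₁ : EntriesMemLp 2 a b G₁) (hG₂ : EntriesMemLp 2 a b G₂) :
    IsThreePI (fun s => (R₀ s)⁻¹) (fun s θ => kerL₁ b F₁ G₁ F₂ G₂ U V s θ * (R₀ θ)⁻¹)
      (fun s θ => kerL₂ b F₁ G₁ F₂ G₂ U V s θ * (R₀ θ)⁻¹) S ↔
    ∀ f, ∀ᵐ s ∂volume.restrict (Icc a b), (S f s).ofLp = (R₀ s)⁻¹ *ᵥ (f s).ofLp + rowF F₁ F₂ s *ᵥ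
      closedLoop a b U V (fun t => colG G₁ G₂ t *ᵥ ((R₀ t)⁻¹ *ᵥ (f t).ofLp)) s := by
  have hG := h.entriesMemLp_right_mul hab hR₀inv hG₁ hG₂
  rw [isThreePI_iff_of_separable hab hG hG (fun s _ θ _ => kerL₁_mul b _ s θ)
    (fun s _ θ _ => kerL₂_mul b _ s θ)]
  refine forall_congr' fun f => Filter.eventually_congr ?_
  refine ae_restrict_of_forall_mem measurableSet_Icc fun s hs => ?_
  have hVg := intervalIntegrable_mulVec_ofLp hab hG f
  simp only [← Matrix.mulVec_mulVec, Matrix.neg_mulVec, sub_neg_eq_add] at hVg ⊢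
  rw [closedLoop_eq_add (uIcc_of_le hab ▸ hs) hVg, Matrix.mulVec_add, add_assoc]
  simp only [Matrix.mulVec_mulVec]

theorem exists_isThreePI_inverse (hab : a ≤ b)
    (hR₀inv : EntriesMemLp ⊤ a b (fun s => (R₀ s)⁻¹)) (hF₁ : EntriesMemLp 2 a b F₁)
    (hG₁ : EntriesMemLp 2 a b G₁) (hF₂ : EntriesMemLp 2 a b F₂) (hG₂ : EntriesMemLp 2 a b G₂) :
    ∃ S : L2 n a b →L[ℝ] L2 n a b,
      IsThreePI (fun s => (R₀ s)⁻¹) (fun s θ => kerL₁ b F₁ G₁ F₂ G₂ U V s θ * (R₀ θ)⁻¹)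
        (fun s θ => kerL₂ b F₁ G₁ F₂ G₂ U V s θ * (R₀ θ)⁻¹) S := by
  have hG := h.entriesMemLp_right_mul hab hR₀inv hG₁ hG₂
  have hF (M) : EntriesMemLp 2 a b (fun s => rowF F₁ F₂ s * (U s * M)) :=
    (hF₁.rowF hF₂).mul 2 ((h.entriesMemLp_left hab).mul ⊤
      (entriesMemLp_top_of_continuousOn continuousOn_const))
  exact exists_isThreePI_of_separable hab hR₀inv (hF _) hG (hF _).neg hG
    (fun s _ θ _ => kerL₁_mul b _ s θ) (fun s _ θ _ => kerL₂_mul b _ s θ)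

end IsFundamentalPair

end Formulas

section Invertibility

theorem inv_mulVec_eq_iff {m : Type*} [Fintype m] [DecidableEq m] {M : Matrix m m ℝ}
    (hM : IsUnit M) {v w : m → ℝ} : M⁻¹ *ᵥ w = v ↔ M *ᵥ v = w := by
  have hdet := (Matrix.isUnit_iff_isUnit_det M).1 hM
  constructor <;> rintro rfl
  · rw [Matrix.mulVec_mulVec, Matrix.mul_nonsing_inv M hdet, Matrix.one_mulVec]
  · rw [Matrix.mulVec_mulVec, Matrix.nonsing_inv_mul M hdet, Matrix.one_mulVec]

theorem eq_neg_mul_mul_of_inv_mul_eq {m k : Type*} [Fintype m] [DecidableEq m] [Fintype k]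
    {M K : Matrix m m ℝ} {F : Matrix m k ℝ} {G : Matrix k m ℝ} (hM : IsUnit M)
    (hK : M⁻¹ * K = -(F * G)) : K = -(M * F) * G := by
  rw [Matrix.neg_mul, Matrix.mul_assoc, ← Matrix.mul_neg, ← hK,
    Matrix.mul_nonsing_inv_cancel_left _ _ ((Matrix.isUnit_iff_isUnit_det M).1 hM)]

variable {n p q : ℕ} {a b : ℝ} {R₀ : ℝ → Matrix (Fin n) (Fin n) ℝ}
  {R₁ R₂ : ℝ → ℝ → Matrix (Fin n) (Fin n) ℝ} {F₁ : ℝ → Matrix (Fin n) (Fin p) ℝ}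
  {G₁ : ℝ → Matrix (Fin p) (Fin n) ℝ} {F₂ : ℝ → Matrix (Fin n) (Fin q) ℝ}
  {G₂ : ℝ → Matrix (Fin q) (Fin n) ℝ} {U V : ℝ → Matrix (Fin p ⊕ Fin q) (Fin p ⊕ Fin q) ℝ}
  {T S : L2 n a b →L[ℝ] L2 n a b}

theorem IsFundamentalPair.apply_eq_iff_apply_eq (hab : a ≤ b)
    (h : IsFundamentalPair a b (coeff F₁ G₁ F₂ G₂) U V) (hU : IsUnit (U b).toBlocks₂₂)
    (hR₀ : ∀ s ∈ Icc a b, IsUnit (R₀ s)) (hR₀inv : EntriesMemLp ⊤ a b (fun s => (R₀ s)⁻¹))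
    (hG₁ : EntriesMemLp 2 a b G₁) (hG₂ : EntriesMemLp 2 a b G₂)
    (hR₁ : ∀ s ∈ Icc a b, ∀ θ ∈ Icc a b, R₁ s θ = -(R₀ s * F₁ s) * G₁ θ)
    (hR₂ : ∀ s ∈ Icc a b, ∀ θ ∈ Icc a b, R₂ s θ = -(R₀ s * F₂ s) * G₂ θ)
    (hT : IsThreePI R₀ R₁ R₂ T)
    (hS : IsThreePI (fun s => (R₀ s)⁻¹) (fun s θ => kerL₁ b F₁ G₁ F₂ G₂ U V s θ * (R₀ θ)⁻¹)
      (fun s θ => kerL₂ b F₁ G₁ F₂ G₂ U V s θ * (R₀ θ)⁻¹) S) {x f : L2 n a b} :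
    T x = f ↔ S f = x := by
  have hTx := (isThreePI_iff_twoPointPrimitive hab hG₁ hG₂ hR₁ hR₂).1 hT x
  have hSf := (h.isThreePI_iff_closedLoop hab hR₀inv hG₁ hG₂).1 hS f
  have hBx := intervalIntegrable_mulVec_ofLp hab (hG₁.colG hG₂) x
  have hBy := intervalIntegrable_mulVec_ofLp hab ((hG₁.colG hG₂).mul 2 hR₀inv) f
  simp only [← Matrix.mulVec_mulVec] at hBy
  rw [funext coeff_eq_colG_mul_rowF] at h
  have hfeedback := h.ae_eq_sub_twoPointPrimitive_iff hU hBx hBy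
  rw [← ae_restrict_Icc_iff hab, ← ae_restrict_Icc_iff hab] at hfeedback
  rw [Lp.ext_iff, Lp.ext_iff]
  refine Iff.trans (Filter.eventually_congr ?_) (hfeedback.trans (Filter.eventually_congr ?_))
  · filter_upwards [hTx, ae_restrict_mem measurableSet_Icc] with s hs hsI
    rw [inv_mulVec_eq_iff (hR₀ s hsI), ← hs]
    exact (WithLp.ofLp_injective 2).eq_iff.symm
  · filter_upwards [hSf] with s hs
    rw [← hs, eq_comm]
    exact (WithLp.ofLp_injective 2).eq_iff

theorem IsFundamentalPair.exists_isThreePI_comp_eq_id (hab : a ≤ b)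
    (h : IsFundamentalPair a b (coeff F₁ G₁ F₂ G₂) U V) (hU : IsUnit (U b).toBlocks₂₂)
    (hR₀ : ∀ s ∈ Icc a b, IsUnit (R₀ s)) (hR₀inv : EntriesMemLp ⊤ a b (fun s => (R₀ s)⁻¹))
    (hF₁ : EntriesMemLp 2 a b F₁) (hG₁ : EntriesMemLp 2 a b G₁) (hF₂ : EntriesMemLp 2 a b F₂)
    (hG₂ : EntriesMemLp 2 a b G₂)
    (hR₁ : ∀ s ∈ Icc a b, ∀ θ ∈ Icc a b, R₁ s θ = -(R₀ s * F₁ s) * G₁ θ)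
    (hR₂ : ∀ s ∈ Icc a b, ∀ θ ∈ Icc a b, R₂ s θ = -(R₀ s * F₂ s) * G₂ θ)
    (hT : IsThreePI R₀ R₁ R₂ T) :
    ∃ S : L2 n a b →L[ℝ] L2 n a b,
      IsThreePI (fun s => (R₀ s)⁻¹) (fun s θ => kerL₁ b F₁ G₁ F₂ G₂ U V s θ * (R₀ θ)⁻¹)
        (fun s θ => kerL₂ b F₁ G₁ F₂ G₂ U V s θ * (R₀ θ)⁻¹) S ∧
      T.comp S = .id ℝ (L2 n a b) ∧ S.comp T = .id ℝ (L2 n a b) := by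
  obtain ⟨S, hS⟩ := h.exists_isThreePI_inverse hab hR₀inv hF₁ hG₁ hF₂ hG₂
  have hiff {x f : L2 n a b} : T x = f ↔ S f = x :=
    h.apply_eq_iff_apply_eq hab hU hR₀ hR₀inv hG₁ hG₂ hR₁ hR₂ hT hS
  exact ⟨S, hS, ContinuousLinearMap.ext fun _ => hiff.2 rfl,
    ContinuousLinearMap.ext fun _ => hiff.1 rfl⟩

theorem exists_ofLp_ae_eq {f : ℝ → Fin n → ℝ} (hf : MemLp f 2 (volume.restrict (Icc a b))) :
    ∃ x : L2 n a b, ∀ᵐ t ∂volume.restrict (Icc a b), (x t).ofLp = f t := by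
  have hmem := (PiLp.continuousLinearEquiv 2 ℝ fun _ : Fin n => ℝ).symm.toContinuousLinearMap
    |>.comp_memLp' hf
  exact ⟨hmem.toLp, hmem.coeFn_toLp.mono fun t ht => congrArg WithLp.ofLp ht⟩

theorem memLp_mulVec_of_continuousOn {l m : Type} [Fintype l] [Fintype m] {M : ℝ → Matrix l m ℝ}
    {z : ℝ → m → ℝ} (hM : EntriesMemLp 2 a b M) (hz : ContinuousOn z (Icc a b)) :
    MemLp (fun t => M t *ᵥ z t) 2 (volume.restrict (Icc a b)) :=
  (mulVecL l m).memLp_of_bilin (q := ⊤) 2 (entriesMemLp_iff.1 hM)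
    (memLp_top_of_continuousOn hz)

theorem IsFundamentalPair.exists_ne_zero_apply_eq_zero (hab : a ≤ b)
    (h : IsFundamentalPair a b (coeff F₁ G₁ F₂ G₂) U V) (hU : ¬IsUnit (U b).toBlocks₂₂)
    (hF₁ : EntriesMemLp 2 a b F₁) (hG₁ : EntriesMemLp 2 a b G₁)
    (hF₂ : EntriesMemLp 2 a b F₂) (hG₂ : EntriesMemLp 2 a b G₂)
    (hR₁ : ∀ s ∈ Icc a b, ∀ θ ∈ Icc a b, R₁ s θ = -(R₀ s * F₁ s) * G₁ θ)
    (hR₂ : ∀ s ∈ Icc a b, ∀ θ ∈ Icc a b, R₂ s θ = -(R₀ s * F₂ s) * G₂ θ)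
    (hT : IsThreePI R₀ R₁ R₂ T) : ∃ x ≠ 0, T x = 0 := by
  obtain ⟨z, hza, hzcont, hz⟩ := h.exists_eqOn_twoPointPrimitive_of_not_isUnit hU
  obtain ⟨x, hx⟩ := exists_ofLp_ae_eq
    (memLp_mulVec_of_continuousOn (hF₁.rowF hF₂) (uIcc_of_le hab ▸ hzcont))
  have hprim : EqOn (twoPointPrimitive a b fun t => colG G₁ G₂ t *ᵥ (x t).ofLp) z (uIcc a b) := by
    refine (eqOn_twoPointPrimitive_of_ae_eq ?_).trans hz.symm
    filter_upwards [(ae_restrict_Icc_iff hab).1 hx] with t ht hts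
    rw [ht hts, coeff_eq_colG_mul_rowF, Matrix.mulVec_mulVec]
  refine ⟨x, fun hx₀ => hza ?_, Lp.ext ?_⟩
  · have hBx : ∀ᵐ t, t ∈ uIoc a b → colG G₁ G₂ t *ᵥ (x t).ofLp = 0 := by
      refine (ae_restrict_Icc_iff hab).1 ?_
      filter_upwards [Lp.coeFn_zero (EuclideanSpace ℝ (Fin n)) 2 (volume.restrict (Icc a b))]
        with t ht
      rw [hx₀, ht, Pi.zero_apply, WithLp.ofLp_zero, Matrix.mulVec_zero]
    rw [← hprim left_mem_uIcc, eqOn_twoPointPrimitive_of_ae_eq hBx left_mem_uIcc]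
    ext (i | j) <;> simp [twoPointPrimitive]
  · filter_upwards [(isThreePI_iff_twoPointPrimitive hab hG₁ hG₂ hR₁ hR₂).1 hT x, hx,
      ae_restrict_mem measurableSet_Icc,
      Lp.coeFn_zero (EuclideanSpace ℝ (Fin n)) 2 (volume.restrict (Icc a b))] with s hs hxs hsI h₀
    rw [hprim (uIcc_of_le hab ▸ hsI), hxs, sub_self, Matrix.mulVec_zero] at hs
    rw [h₀, Pi.zero_apply]
    exact WithLp.ofLp_injective 2 hs

end Invertibility

end ThreePI

theorem mainTheorem12 {n p q : ℕ} {a b : ℝ} (hab : a ≤ b)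
    (R₀ : ℝ → Matrix (Fin n) (Fin n) ℝ) (R₁ R₂ : ℝ → ℝ → Matrix (Fin n) (Fin n) ℝ)
    (hR₀ : ThreePI.EntriesMemLp ⊤ a b R₀)
    (hR₀unit : ∀ s ∈ Set.Icc a b, IsUnit (R₀ s))
    (hR₀inv : ThreePI.EntriesMemLp ⊤ a b (fun s => (R₀ s)⁻¹))
    (F₁ : ℝ → Matrix (Fin n) (Fin p) ℝ) (G₁ : ℝ → Matrix (Fin p) (Fin n) ℝ)
    (F₂ : ℝ → Matrix (Fin n) (Fin q) ℝ) (G₂ : ℝ → Matrix (Fin q) (Fin n) ℝ)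
    (hF₁ : ThreePI.EntriesMemLp 2 a b F₁) (hG₁ : ThreePI.EntriesMemLp 2 a b G₁)
    (hF₂ : ThreePI.EntriesMemLp 2 a b F₂) (hG₂ : ThreePI.EntriesMemLp 2 a b G₂)
    (hfac₁ : ∀ s ∈ Set.Icc a b, ∀ θ ∈ Set.Icc a b, (R₀ s)⁻¹ * R₁ s θ = -(F₁ s * G₁ θ))
    (hfac₂ : ∀ s ∈ Set.Icc a b, ∀ θ ∈ Set.Icc a b, (R₀ s)⁻¹ * R₂ s θ = -(F₂ s * G₂ θ)) :
    -- existence and uniqueness on `[a,b]` of `U` and of `V`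
    (∃ U, ThreePI.IsFundamental a b (ThreePI.coeff F₁ G₁ F₂ G₂) U ∧
      ∀ U', ThreePI.IsFundamental a b (ThreePI.coeff F₁ G₁ F₂ G₂) U' →
        Set.EqOn U' U (Set.Icc a b)) ∧
    (∃ V, ThreePI.IsAdjointFundamental a b (ThreePI.coeff F₁ G₁ F₂ G₂) V ∧
      ∀ V', ThreePI.IsAdjointFundamental a b (ThreePI.coeff F₁ G₁ F₂ G₂) V' →
        Set.EqOn V' V (Set.Icc a b)) ∧
    -- invertibility criterion and formula for the inverse
    ∀ U V, ThreePI.IsFundamental a b (ThreePI.coeff F₁ G₁ F₂ G₂) U →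
      ThreePI.IsAdjointFundamental a b (ThreePI.coeff F₁ G₁ F₂ G₂) V →
      ∃ T : ThreePI.L2 n a b →L[ℝ] ThreePI.L2 n a b,
        ThreePI.IsThreePI R₀ R₁ R₂ T ∧
        (IsUnit T ↔ IsUnit (U b).toBlocks₂₂) ∧
        (IsUnit (U b).toBlocks₂₂ →
          ∃ S : ThreePI.L2 n a b →L[ℝ] ThreePI.L2 n a b,
            ThreePI.IsThreePI (fun s => (R₀ s)⁻¹)
              (fun s θ => ThreePI.kerL₁ b F₁ G₁ F₂ G₂ U V s θ * (R₀ θ)⁻¹)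
              (fun s θ => ThreePI.kerL₂ b F₁ G₁ F₂ G₂ U V s θ * (R₀ θ)⁻¹) S ∧
            T.comp S = ContinuousLinearMap.id ℝ (ThreePI.L2 n a b) ∧
            S.comp T = ContinuousLinearMap.id ℝ (ThreePI.L2 n a b)) := by
  have hA := ThreePI.intervalIntegrable_coeff hab hF₁ hG₁ hF₂ hG₂
  refine ⟨ThreePI.exists_isFundamental hab hA, ThreePI.exists_isAdjointFundamental hab hA,
    fun U V hU hV => ?_⟩
  have h := (ThreePI.isFundamentalPair_iff hab).2 ⟨hU, hV⟩
  have hR₁ := fun s hs θ hθ =>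
    ThreePI.eq_neg_mul_mul_of_inv_mul_eq (hR₀unit s hs) (hfac₁ s hs θ hθ)
  have hR₂ := fun s hs θ hθ =>
    ThreePI.eq_neg_mul_mul_of_inv_mul_eq (hR₀unit s hs) (hfac₂ s hs θ hθ)
  obtain ⟨T, hT⟩ := ThreePI.exists_isThreePI_of_separable hab hR₀ (hR₀.mul 2 hF₁).neg hG₁
    (hR₀.mul 2 hF₂).neg hG₂ hR₁ hR₂
  have hinverse := fun hU_unit =>
    h.exists_isThreePI_comp_eq_id hab hU_unit hR₀unit hR₀inv hF₁ hG₁ hF₂ hG₂ hR₁ hR₂ hT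
  refine ⟨T, hT, ⟨fun hT_unit => ?_, fun hU_unit => ?_⟩, hinverse⟩
  · by_contra hU_unit
    obtain ⟨x, hx, hTx⟩ :=
      h.exists_ne_zero_apply_eq_zero hab hU_unit hF₁ hG₁ hF₂ hG₂ hR₁ hR₂ hT
    exact hx ((ContinuousLinearMap.isUnit_iff_bijective.1 hT_unit).1 (hTx.trans (map_zero T).symm))
  · obtain ⟨S, -, hTS, hST⟩ := hinverse hU_unit
    exact ⟨⟨T, S, hTS, hST⟩, rfl⟩
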